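/- **Theorem 3 (Non-extremal, vacuum isolated null surface).** Let $n>2$. A *space-time* is a smooth $n$-dimensional manifold with a smooth metric tensor $g$ of signature $(-,+,\dots,+)$ and Levi-Civita connection $\nabla$. A *null surface* is an embedded $(n-1)$-dimensional submanifold $\mathcal I$ on which the pullback $q$ of $g$ is degenerate at every point; it is *non-expanding* if at every point the trace of the bilinear form $(X,Y)\mapsto g(\nabla_X\ell,Y)$ over the quotient of the tangent space by the null direction vanishes for some (equivalently, every) tangent null vector field $\ell$ that is non-zero there. An *isolated null surface* $(\mathcal I,[\ell])$ is a non-expanding null surface, with induced covariant derivative $D_XY=\nabla_XY$ ($X,Y$ tangent to $\mathcal I$), together with a nowhere vanishing tangent null vector field $\ell$, taken up to a constant factor, such that $\mathcal L_\ell q=0$ and $[\mathcal L_\ell,D]=0$. Its *geometry* is the pair $(q,D)$; its *rotation 1-form potential* $\omega$ and its *surface gravity* $\kappa$ are defined by $D_a\ell^b=\omega_a\ell^b$ and $D_\ell\ell=\kappa\,\ell$. It is *non-extremal* if $\kappa\neq0$. The geometry of a non-extremal isolated null surface at which the vacuum Einstein equations $\mathrm{Ric}-\tfrac12Rg=-\Lambda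 g$ with cosmological constant $\Lambda$ hold is determined by $q$, $\omega$ and $\Lambda$. That is: let $\mathcal N$ be an $(n-1)$-dimensional manifold, and let $\iota_1:\mathcal N\to M_1$ and $\iota_2:\mathcal N\to M_2$ be embeddings onto non-extremal isolated null surfaces in two $n$-dimensional space-times, with null vector fields $\ell_1,\ell_2$ and induced covariant derivatives $D_1,D_2$ on $\mathcal N$. Suppose that the vacuum Einstein equations with the same cosmological constant $\Lambda$ hold at all points of both surfaces, that the two induced metric tensors on $\mathcal N$ coincide, and that the rotation 1-form potentials of $\ell_1$ and $\ell_2$ coincide. Then $D_1=D_2$. -/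

import Mathlib

open scoped Manifold ContDiff Topology

noncomputable section

namespace NullSurface

/-! ### Space-time: Lorentzian metric, Levi-Civita connection, curvature -/

section Spacetime

variable {n : ℕ} {M : Type*} [TopologicalSpace M] [ChartedSpace (EuclideanSpace ℝ (Fin n)) M]
  [IsManifold (𝓡 n) ∞ M]

/-- A vector field (not assumed to have any regularity). -/
abbrev VField (n : ℕ) (M : Type*) [TopologicalSpace M]
    [ChartedSpace (EuclideanSpace ℝ (Fin n)) M] : Type _ :=
  Π x : M, TangentSpace (𝓡 n) x

/-- The vector field `X` is smooth at the point `x`. -/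
def SmoothAt (X : VField n M) (x : M) : Prop :=
  ContMDiffAt (𝓡 n) (𝓡 n).tangent ∞
    (fun y => (⟨y, X y⟩ : TangentBundle (𝓡 n) M)) x

/-- The vector field `X` is differentiable at the point `x`. -/
def DiffAt (X : VField n M) (x : M) : Prop :=
  MDifferentiableAt (𝓡 n) (𝓡 n).tangent
    (fun y => (⟨y, X y⟩ : TangentBundle (𝓡 n) M)) x

/-- A connection in the tangent bundle of an `n`-dimensional manifold. The value `D Y x (X x)` is
`(D_X Y)(x)`. -/
abbrev Connection (n : ℕ) (M : Type*) [TopologicalSpace M]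
    [ChartedSpace (EuclideanSpace ℝ (Fin n)) M] [IsManifold (𝓡 n) ∞ M] : Type _ :=
  CovariantDerivative (𝓡 n) (EuclideanSpace ℝ (Fin n)) (TangentSpace (𝓡 n) : M → Type _)

/-- `D_X Y` as a vector field. -/
def Connection.along (D : Connection n M) (X Y : VField n M) : VField n M :=
  fun x => D Y x (X x)

/-- The connection `D` is smooth: `D_X Y` is smooth wherever `X` and `Y` are. -/
def Connection.IsSmooth (D : Connection n M) : Prop :=
  ∀ (x : M) (X Y : VField n M), SmoothAt X x → SmoothAt Y x → SmoothAt (D.along X Y) x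

/-- A smooth metric tensor of signature `(-,+,...,+)`. -/
structure LorentzMetric (n : ℕ) (M : Type*) [TopologicalSpace M]
    [ChartedSpace (EuclideanSpace ℝ (Fin n)) M] [IsManifold (𝓡 n) ∞ M] where
  /-- the bilinear form at each point -/
  val : Π x : M, TangentSpace (𝓡 n) x →L[ℝ] TangentSpace (𝓡 n) x →L[ℝ] ℝ
  symm : ∀ (x : M) (u v : TangentSpace (𝓡 n) x), val x u v = val x v u
  signature : ∀ x : M, ∃ t : TangentSpace (𝓡 n) x, val x t t < 0 ∧
    ∀ w : TangentSpace (𝓡 n) x, val x t w = 0 → w ≠ 0 → 0 < val x w w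
  smooth : ContMDiff (𝓡 n)
    ((𝓡 n).prod 𝓘(ℝ, EuclideanSpace ℝ (Fin n) →L[ℝ] EuclideanSpace ℝ (Fin n) →L[ℝ] ℝ)) ∞
    (fun x => Bundle.TotalSpace.mk'
      (EuclideanSpace ℝ (Fin n) →L[ℝ] EuclideanSpace ℝ (Fin n) →L[ℝ] ℝ) x (val x))

/-- `nabla` is the Levi-Civita connection of `g`: a smooth connection which is torsion free and
annihilates `g`. -/
structure IsLeviCivita (g : LorentzMetric n M) (nabla : Connection n M) : Prop where
  smooth : nabla.IsSmooth
  torsion_free : nabla.torsion = 0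
  metric : ∀ (x : M) (Y Z : VField n M), DiffAt Y x → DiffAt Z x →
    ∀ v : TangentSpace (𝓡 n) x,
      mvfderiv (𝓡 n) (fun y => g.val y (Y y) (Z y)) x v
        = g.val x (nabla Y x v) (Z x) + g.val x (Y x) (nabla Z x v)

/-- The curvature `R(X,Y)Z = D_X D_Y Z - D_Y D_X Z - D_[X,Y] Z`. -/
def curvature (D : Connection n M) (X Y Z : VField n M) : VField n M :=
  fun x => D (D.along Y Z) x (X x) - D (D.along X Z) x (Y x)
    - D Z x (VectorField.mlieBracket (𝓡 n) X Y x)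

/-- The curvature on tangent vectors at a point, evaluated through smooth local extensions. -/
def curvatureAt (D : Connection n M) (x : M) (u v w : TangentSpace (𝓡 n) x) :
    TangentSpace (𝓡 n) x :=
  curvature D (FiberBundle.extend (EuclideanSpace ℝ (Fin n)) u)
    (FiberBundle.extend (EuclideanSpace ℝ (Fin n)) v)
    (FiberBundle.extend (EuclideanSpace ℝ (Fin n)) w) x

/-- A basis of the tangent space at `x`, used to write traces. -/
def tangentBasis (x : M) : Module.Basis (Fin n) ℝ (TangentSpace (𝓡 n) x) :=
  (EuclideanSpace.basisFun (Fin n) ℝ).toBasis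

/-- The Ricci tensor `Ric(v,w)`, the trace of `u ↦ R(u,v)w`. -/
def ricci (D : Connection n M) (x : M) (v w : TangentSpace (𝓡 n) x) : ℝ :=
  ∑ i : Fin n, (tangentBasis x).repr (curvatureAt D x (tangentBasis x i) v w) i

/-- The scalar curvature `g^{ij} Ric_{ij}`. -/
def scalarCurvature (g : LorentzMetric n M) (nabla : Connection n M) (x : M) : ℝ :=
  ∑ i : Fin n, ∑ j : Fin n,
    (Matrix.of fun k l : Fin n => g.val x (tangentBasis x k) (tangentBasis x l))⁻¹ i j
      * ricci nabla x (tangentBasis x i) (tangentBasis x j)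

/-- The Einstein tensor `Ric - (1/2) R g`. -/
def einstein (g : LorentzMetric n M) (nabla : Connection n M) (x : M)
    (u v : TangentSpace (𝓡 n) x) : ℝ :=
  ricci nabla x u v - (1 / 2) * scalarCurvature g nabla x * g.val x u v

/-- The vacuum Einstein equations with cosmological constant `Λ` hold at all points of `S`. -/
def VacuumEinsteinOn (g : LorentzMetric n M) (nabla : Connection n M) (Λ : ℝ) (S : Set M) : Prop :=
  ∀ x ∈ S, ∀ u v : TangentSpace (𝓡 n) x, einstein g nabla x u v = -Λ * g.val x u v

end Spacetime

/-! ### Null surfaces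

`N` is an `(n-1)`-dimensional manifold, mapped by `ι` into the `n`-dimensional space-time `M`. -/

section Surface

variable {n : ℕ} {M : Type*} [TopologicalSpace M] [ChartedSpace (EuclideanSpace ℝ (Fin n)) M]
  [IsManifold (𝓡 n) ∞ M]
  {N : Type*} [TopologicalSpace N] [ChartedSpace (EuclideanSpace ℝ (Fin (n - 1))) N]
  [IsManifold (𝓡 (n - 1)) ∞ N]

/-- The pushforward of a tangent vector of the surface to the space-time. -/
abbrev push (ι : N → M) (p : N) : TangentSpace (𝓡 (n - 1)) p →L[ℝ] TangentSpace (𝓡 n) (ι p) :=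
  mfderiv (𝓡 (n - 1)) (𝓡 n) ι p

/-- The induced (degenerate) metric tensor `q`, the pullback of `g` to the surface. -/
def inducedMetric (ι : N → M) (g : LorentzMetric n M) (p : N)
    (u v : TangentSpace (𝓡 (n - 1)) p) : ℝ :=
  g.val (ι p) (push ι p u) (push ι p v)

/-- `ι` embeds `N` as a null surface: an `(n-1)`-dimensional submanifold of the `n`-dimensional
space-time on which the pullback of the metric is degenerate at every point. -/
structure IsNullSurface (g : LorentzMetric n M) (ι : N → M) : Prop where
  embedding : Manifold.IsSmoothEmbedding (𝓡 (n - 1)) (𝓡 n) ∞ ι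
  degenerate : ∀ p : N, ∃ v : TangentSpace (𝓡 (n - 1)) p, v ≠ 0 ∧
    ∀ w : TangentSpace (𝓡 (n - 1)) p, inducedMetric ι g p v w = 0

/-- The vector `v` belongs to the null direction `L_p`, the degeneracy subspace of `q` at `p`. -/
def InNullDirection (g : LorentzMetric n M) (ι : N → M) (p : N)
    (v : TangentSpace (𝓡 (n - 1)) p) : Prop :=
  ∀ w : TangentSpace (𝓡 (n - 1)) p, inducedMetric ι g p v w = 0

/-- The space-time vector field `X'` is, near `ι p`, a smooth extension of the vector field `X`
tangent to the surface. -/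
structure IsExtensionAt (ι : N → M) (p : N) (X : VField (n - 1) N) (X' : VField n M) : Prop where
  smooth : SmoothAt X' (ι p)
  extends_near : ∀ᶠ y in 𝓝 p, X' (ι y) = push ι y (X y)

/-- The family `e` represents a `q`-orthonormal basis of the `(n-2)`-dimensional quotient
`T_p N / L_p`. -/
def IsScreenFrame (g : LorentzMetric n M) (ι : N → M) (p : N)
    (e : Fin (n - 2) → TangentSpace (𝓡 (n - 1)) p) : Prop :=
  ∀ i j, inducedMetric ι g p (e i) (e j) = if i = j then 1 else 0

/-- The null surface is non-expanding: around every point there is a null vector field `ℓ` tangent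
to the surface, not zero at the point, whose expansion, i.e. the trace of `g(∇_a ℓ, ·)` over
`T_p N / L_p`, vanishes at the point. -/
def IsNonExpanding (g : LorentzMetric n M) (nabla : Connection n M) (ι : N → M) : Prop :=
  ∀ p : N, ∃ (ℓ : VField (n - 1) N) (ℓ' : VField n M),
    SmoothAt ℓ p ∧ ℓ p ≠ 0 ∧ (∀ᶠ y in 𝓝 p, InNullDirection g ι y (ℓ y)) ∧
    IsExtensionAt ι p ℓ ℓ' ∧
    ∀ e : Fin (n - 2) → TangentSpace (𝓡 (n - 1)) p, IsScreenFrame g ι p e →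
      ∑ i, g.val (ι p) (nabla ℓ' (ι p) (push ι p (e i))) (push ι p (e i)) = 0

/-- `D` is the covariant derivative induced on the surface: `D_X Y = ∇_X Y` for all vector fields
`X`, `Y` tangent to the surface. -/
structure IsInducedConnection (nabla : Connection n M) (ι : N → M) (D : Connection (n - 1) N) :
    Prop where
  smooth : D.IsSmooth
  eq : ∀ (p : N) (Y : VField (n - 1) N) (Y' : VField n M), SmoothAt Y p → IsExtensionAt ι p Y Y' →
    ∀ v : TangentSpace (𝓡 (n - 1)) p, push ι p (D Y p v) = nabla Y' (ι p) (push ι p v)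

/-- The Lie derivative `(L_ℓ q)(X,Y)` at `p`. -/
def lieMetric (g : LorentzMetric n M) (ι : N → M) (ℓ X Y : VField (n - 1) N) (p : N) : ℝ :=
  mvfderiv (𝓡 (n - 1)) (fun y => inducedMetric ι g y (X y) (Y y)) p (ℓ p)
    - inducedMetric ι g p (VectorField.mlieBracket (𝓡 (n - 1)) ℓ X p) (Y p)
    - inducedMetric ι g p (X p) (VectorField.mlieBracket (𝓡 (n - 1)) ℓ Y p)

/-- The commutator `[L_ℓ, D]`, i.e. `L_ℓ (D_X Y) - D_{L_ℓ X} Y - D_X (L_ℓ Y)`, at `p`. -/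
def lieConnection (D : Connection (n - 1) N) (ℓ X Y : VField (n - 1) N) (p : N) :
    TangentSpace (𝓡 (n - 1)) p :=
  VectorField.mlieBracket (𝓡 (n - 1)) ℓ (D.along X Y) p
    - D Y p (VectorField.mlieBracket (𝓡 (n - 1)) ℓ X p)
    - D (VectorField.mlieBracket (𝓡 (n - 1)) ℓ Y) p (X p)

/-- `(N, [ℓ])` is an isolated null surface, with induced covariant derivative `D`: a non-expanding
null surface with a nowhere vanishing tangent null vector field `ℓ` whose flow preserves the
geometry `(q, D)`. The field `ℓ` stands for its class up to constant factors. -/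
structure IsIsolatedNullSurface (g : LorentzMetric n M) (nabla : Connection n M) (ι : N → M)
    (D : Connection (n - 1) N) (ℓ : VField (n - 1) N) : Prop where
  null : IsNullSurface g ι
  non_expanding : IsNonExpanding g nabla ι
  induced : IsInducedConnection nabla ι D
  flow_smooth : ∀ p, SmoothAt ℓ p
  flow_ne_zero : ∀ p, ℓ p ≠ 0
  flow_null : ∀ p, InNullDirection g ι p (ℓ p)
  lie_metric : ∀ (p : N) (X Y : VField (n - 1) N), SmoothAt X p → SmoothAt Y p →
    lieMetric g ι ℓ X Y p = 0
  lie_connection : ∀ (p : N) (X Y : VField (n - 1) N), SmoothAt X p → SmoothAt Y p →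
    lieConnection D ℓ X Y p = 0

/-- The surface gravity `κ`, given by `D_ℓ ℓ = κ ℓ`, vanishes nowhere. -/
def IsNonExtremal (D : Connection (n - 1) N) (ℓ : VField (n - 1) N) : Prop :=
  ∀ p, ∃ κ : ℝ, κ ≠ 0 ∧ D ℓ p (ℓ p) = κ • ℓ p

/-- `rot` is the rotation 1-form potential of `ℓ`: `D_a ℓ = rot_a ℓ`. -/
def IsRotationPotential (D : Connection (n - 1) N) (ℓ : VField (n - 1) N)
    (rot : Π p : N, TangentSpace (𝓡 (n - 1)) p →L[ℝ] ℝ) : Prop :=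
  ∀ (p : N) (v : TangentSpace (𝓡 (n - 1)) p), D ℓ p v = rot p v • ℓ p

end Surface

end NullSurface

end

/-! The difference C = D₁ - D₂ is a tensor. Both connections are torsion free and annihilate the
same q, so C is symmetric with values in the one-dimensional degeneracy direction of q: C(u,v) =
S(u,v) ℓ (`difference_symm`, `difference_null`). It remains to kill S.

The symmetry [L_ℓ, D] = 0 turns R(ℓ,X)Y into first-order data: it equals -((D_X ω)(Y) + ω(X) ω(Y)) ℓ
(`curvature_flow`). Since T_pN is the hyperplane orthogonal to ℓ, the space-time Ricci tensor on
tangent vectors is the trace of the curvature of D plus one transversal term, which by pair symmetry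
is the coefficient of R(ℓ,w)v along ℓ (`ricci_push`). Thus Ricci on the surface is computed from D
alone.

Einstein's equations are used twice. Ric(v,ℓ) = 0 gives dκ = 0, the zeroth law
(`surfaceGravity_const`). The two null fields satisfy ℓ₂ = f ℓ₁, hence κ₂ = f κ₁, and κ₁ ≠ 0 forces
df = 0, so ω is also the potential of ℓ₁ for D₂ (`rotation_of_other_normal`). Finally, Ric is the
same multiple of q on both surfaces. In the difference of the two Ricci tensors the curvatures
differ by multiples of ℓ (`curvature_difference`), so both the trace and the transversal term reduce
to a coefficient of R(ℓ,·)·, where the derivatives of ω cancel. Each contributes ω(C(u,v)) = κ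
S(u,v). Hence 2κS = 0, and non-extremality gives S = 0. -/

open scoped Manifold ContDiff Topology

noncomputable section

namespace NullSurface

set_option linter.unusedSectionVars false

/-! ### Smoothness, directional derivatives and Lie brackets at a point. -/

section General
variable {n : ℕ} {M : Type*} [TopologicalSpace M] [ChartedSpace (EuclideanSpace ℝ (Fin n)) M]
  [IsManifold (𝓡 n) ∞ M]

/-- The function `f` is smooth at `x`. -/
abbrev FunSmoothAt (f : M → ℝ) (x : M) : Prop := ContMDiffAt (𝓡 n) 𝓘(ℝ, ℝ) ∞ f x

/-- The function `f` is differentiable at `x`. -/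
abbrev FunDiffAt (f : M → ℝ) (x : M) : Prop := MDifferentiableAt (𝓡 n) 𝓘(ℝ, ℝ) f x

theorem SmoothAt.diffAt {X : VField n M} {x : M} (h : SmoothAt X x) : DiffAt X x :=
  ContMDiffAt.mdifferentiableAt h (by simp)

theorem SmoothAt.eventually_diffAt {X : VField n M} {x : M} (h : SmoothAt X x) :
    ∀ᶠ y in 𝓝 x, DiffAt X y := by
  have h1 : ContMDiffAt (𝓡 n) (𝓡 n).tangent 1 (fun y => (⟨y, X y⟩ : TangentBundle (𝓡 n) M)) x :=
    ContMDiffAt.of_le h (by exact_mod_cast le_top)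
  filter_upwards [(contMDiffAt_iff_contMDiffAt_nhds (by simp)).1 h1] with y hy
  exact ContMDiffAt.mdifferentiableAt hy (by simp)

theorem FunSmoothAt.diffAt {f : M → ℝ} {x : M} (h : FunSmoothAt (n := n) f x) : FunDiffAt
    (n := n) f x :=
  ContMDiffAt.mdifferentiableAt h (by simp)

theorem FunSmoothAt.eventually_diffAt {f : M → ℝ} {x : M} (h : FunSmoothAt (n := n) f x) :
    ∀ᶠ y in 𝓝 x, FunDiffAt (n := n) f y := by
  have h1 : ContMDiffAt (𝓡 n) 𝓘(ℝ, ℝ) 1 f x :=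
    ContMDiffAt.of_le h (by exact_mod_cast le_top)
  filter_upwards [(contMDiffAt_iff_contMDiffAt_nhds (by simp)).1 h1] with y hy
  exact ContMDiffAt.mdifferentiableAt hy (by simp)

theorem SmoothAt.add {X Y : VField n M} {x : M} (hX : SmoothAt X x) (hY : SmoothAt Y x) :
    SmoothAt (X + Y) x :=
  ContMDiffAt.add_section hX hY

theorem SmoothAt.sub {X Y : VField n M} {x : M} (hX : SmoothAt X x) (hY : SmoothAt Y x) :
    SmoothAt (X - Y) x :=
  ContMDiffAt.sub_section hX hY

theorem SmoothAt.smul {f : M → ℝ} {X : VField n M} {x : M} (hf : FunSmoothAt (n := n) f x)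
    (hX : SmoothAt X x) :
    SmoothAt (f • X) x :=
  ContMDiffAt.smul_section hf hX

theorem SmoothAt.congr {X Y : VField n M} {x : M} (hX : SmoothAt X x) (h : ∀ᶠ y in 𝓝 x, Y y = X y) :
    SmoothAt Y x :=
  ContMDiffAt.congr_of_eventuallyEq hX (h.mono fun y hy => by simp [hy])

theorem smoothAt_extend (x : M) (v : TangentSpace (𝓡 n) x) :
    SmoothAt (FiberBundle.extend (EuclideanSpace ℝ (Fin n)) v) x :=
  FiberBundle.contMDiffAt_extend (𝓡 n) _ v

theorem two_le_infty : (2 : WithTop ℕ∞) ≤ ∞ := by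
  have h : ((2 : ℕ∞) : WithTop ℕ∞) ≤ ((⊤ : ℕ∞) : WithTop ℕ∞) := WithTop.coe_le_coe.2 le_top
  exact h

theorem three_le_infty : (3 : WithTop ℕ∞) ≤ ∞ := by
  have h : ((3 : ℕ∞) : WithTop ℕ∞) ≤ ((⊤ : ℕ∞) : WithTop ℕ∞) := WithTop.coe_le_coe.2 le_top
  exact h

/-- The derivative of the function `f` along the vector field `X`. -/
def dirDeriv (X : VField n M) (f : M → ℝ) : M → ℝ := fun y => mvfderiv (𝓡 n) f y (X y)

theorem FunSmoothAt.dirDeriv {X : VField n M} {f : M → ℝ} {x : M} (hf : FunSmoothAt (n := n) f x)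
    (hX : SmoothAt X x) : FunSmoothAt (n := n) (dirDeriv X f) x := by
  have h1 := ContMDiffAt.mfderiv_const hf (m := ∞) (by simp)
  have h2 := ContMDiffAt.clm_apply_of_inCoordinates  (IM := 𝓡 n) (b₁ := id) (b₂ := f)
      (ϕ := fun y => mfderiv (𝓡 n) 𝓘(ℝ, ℝ) f y) (v := X) h1 (by exact hX) hf
  rw [Bundle.contMDiffAt_totalSpace] at h2
  simpa [NullSurface.dirDeriv, mvfderiv] using! h2.2

theorem smooth_lieBracket {X Y : VField n M} {x : M} (hX : SmoothAt X x) (hY : SmoothAt Y x) :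
    SmoothAt (VectorField.mlieBracket (𝓡 n) X Y) x := by
  have : IsManifold (𝓡 n) (∞ + 1) M := ‹IsManifold (𝓡 n) ∞ M›
  have : IsManifold (𝓡 n) (minSmoothness ℝ 2) M := by
    simp only [minSmoothness_of_isRCLikeNormedField]
    exact IsManifold.of_le (n := ∞) two_le_infty
  exact ContMDiffAt.mlieBracket_vectorField (m := ⊤) (n := ⊤) hX hY (by simp)

theorem lieBracket_congr {X X' Y Y' : VField n M} {x : M} (hX : ∀ᶠ y in 𝓝 x, X y = X' y)
    (hY : ∀ᶠ y in 𝓝 x, Y y = Y' y) : VectorField.mlieBracket (𝓡 n) X Y x = VectorField.mlieBracket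
        (𝓡 n) X' Y' x :=
  Filter.EventuallyEq.mlieBracket_vectorField_eq hX hY

theorem Connection.congr_of_eventually (D : Connection n M) {Y Y' : VField n M} {x : M}
    (hY : DiffAt Y x)
    (hY' : DiffAt Y' x) (h : ∀ᶠ y in 𝓝 x, Y y = Y' y) : D Y x = D Y' x :=
  D.isCovariantDerivativeOnUniv.congr_of_eventuallyEq hY hY' Filter.univ_mem h

theorem jacobi {X Y Z : VField n M} {x : M} (hX : SmoothAt X x) (hY : SmoothAt Y x)
    (hZ : SmoothAt Z x) :
    VectorField.mlieBracket (𝓡 n) X (VectorField.mlieBracket (𝓡 n) Y Z) x =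
    VectorField.mlieBracket (𝓡 n) (VectorField.mlieBracket (𝓡 n) X Y) Z x +
    VectorField.mlieBracket (𝓡 n) Y (VectorField.mlieBracket (𝓡 n) X Z) x := by
  have : IsManifold (𝓡 n) (minSmoothness ℝ 3) M := by
    simp only [minSmoothness_of_isRCLikeNormedField]
    exact IsManifold.of_le (n := ∞) three_le_infty
  have h2 : minSmoothness ℝ 2 ≤ (∞ : WithTop ℕ∞) := by
    simp only [minSmoothness_of_isRCLikeNormedField]
    exact two_le_infty
  exact VectorField.leibniz_identity_mlieBracket_apply (ContMDiffAt.of_le hX h2)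
      (ContMDiffAt.of_le hY h2) (ContMDiffAt.of_le hZ h2)

end General

/-! ### Commutators of derivations, and tensoriality over smooth functions. -/

section Tensor
variable {n : ℕ} {M : Type*} [TopologicalSpace M] [ChartedSpace (EuclideanSpace ℝ (Fin n)) M]
  [IsManifold (𝓡 n) ∞ M]

/-- The Jacobi identity for X, Y, fZ, minus f times the one for X, Y, Z, leaves exactly the scalar
identity multiplied by Z. A field Z that is non-zero at x then gives the claim; if the tangent space
is trivial, both sides vanish. -/
theorem dirDeriv_commutator {X Y : VField n M} {f : M → ℝ} {x : M} (hf : FunSmoothAt (n := n) f x)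
    (hX : SmoothAt X x) (hY : SmoothAt Y x) :
    dirDeriv X (dirDeriv Y f) x - dirDeriv Y (dirDeriv X f) x
      = dirDeriv (VectorField.mlieBracket (𝓡 n) X Y) f x := by
  rcases subsingleton_or_nontrivial (TangentSpace (𝓡 n) x) with h | h
  · simp [dirDeriv, Subsingleton.elim _ (0 : TangentSpace (𝓡 n) x)]
  obtain ⟨w, hw⟩ := exists_ne (0 : TangentSpace (𝓡 n) x)
  set Z : VField n M := FiberBundle.extend (EuclideanSpace ℝ (Fin n)) w with hZdef
  have hZ : SmoothAt Z x := smoothAt_extend x w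
  have hZx : Z x = w := by simp [Z]
  have bracket_smul : ∀ {V W : VField n M} {h : M → ℝ} {y : M}, FunDiffAt
      (n := n) h y → DiffAt W y →
      VectorField.mlieBracket (𝓡 n) V (h • W) y
        = dirDeriv V h y • W y + h y • VectorField.mlieBracket (𝓡 n) V W y :=
    fun hh hW => VectorField.mlieBracket_smul_right hh hW
  have expand : ∀ {V : VField n M}, SmoothAt V x →
      ∀ᶠ y in 𝓝 x, VectorField.mlieBracket (𝓡 n) V (f • Z) y
        = (dirDeriv V f • Z + f • VectorField.mlieBracket (𝓡 n) V Z) y := by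
    intro V hV
    filter_upwards [hf.eventually_diffAt, hZ.eventually_diffAt] with y h1 h2
    exact bracket_smul h1 h2
  have refl' : ∀ {V : VField n M}, ∀ᶠ y in 𝓝 x, V y = V y := Filter.Eventually.of_forall fun _ =>
      rfl
  have second : ∀ {U V : VField n M}, SmoothAt U x → SmoothAt V x →
      VectorField.mlieBracket (𝓡 n) U (VectorField.mlieBracket (𝓡 n) V (f • Z)) x
        = dirDeriv U (dirDeriv V f) x • Z x + dirDeriv V f x • VectorField.mlieBracket (𝓡 n) U Z x
          + (dirDeriv U f x • VectorField.mlieBracket (𝓡 n) V Z x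
            + f x • VectorField.mlieBracket (𝓡 n) U (VectorField.mlieBracket (𝓡 n) V Z) x) := by
    intro U V hU hV
    rw [lieBracket_congr refl' (expand hV),
      VectorField.mlieBracket_add_right (SmoothAt.smul (hf.dirDeriv hV) hZ).diffAt
        (SmoothAt.smul hf (smooth_lieBracket hV hZ)).diffAt,
      bracket_smul (hf.dirDeriv hV).diffAt hZ.diffAt,
      bracket_smul hf.diffAt (smooth_lieBracket hV hZ).diffAt]
  have J1 := jacobi hX hY (SmoothAt.smul hf hZ)
  have J2 := jacobi hX hY hZ
  rw [second hX hY, second hY hX, bracket_smul hf.diffAt hZ.diffAt, J2, hZx] at J1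
  have : (dirDeriv X (dirDeriv Y f) x - dirDeriv Y (dirDeriv X f) x
      - dirDeriv (VectorField.mlieBracket (𝓡 n) X Y) f x) • w = 0 := by
    rw [sub_smul, sub_smul]
    rw [← sub_eq_zero] at J1
    rw [← J1]
    module
  rcases smul_eq_zero.1 this with h0 | h0
  · linarith
  · exact absurd h0 hw

/-- An operation on vector fields which is linear over functions smooth at `x`. -/
structure IsSmoothTensorial {A : Type*} [AddCommGroup A] [Module ℝ A] (Φ : VField n M → A) (x : M) :
    Prop where
  smul : ∀ {f : M → ℝ} {X : VField n M}, FunSmoothAt (n := n) f x → SmoothAt X x → Φ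
      (f • X) = f x • Φ X
  add : ∀ {X Y : VField n M}, SmoothAt X x → SmoothAt Y x → Φ (X + Y) = Φ X + Φ Y

theorem SmoothAt.sum {ι : Type*} {s : Finset ι} {X : ι → VField n M} {x : M} (h : ∀ i, SmoothAt
    (X i) x) :
    SmoothAt (fun y => ∑ i ∈ s, X i y) x :=
  ContMDiffAt.sum_section fun i _ => h i

namespace IsSmoothTensorial
variable {A : Type*} [AddCommGroup A] [Module ℝ A] {Φ : VField n M → A} {x : M}

/-- Locality follows from linearity over functions: the indicator ψ of the set where X = Y satisfies
ψX = ψY everywhere, and it is smooth at x because it is 1 near x. No bump function is needed. -/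
theorem congr (hΦ : IsSmoothTensorial Φ x) {X Y : VField n M} (hX : SmoothAt X x)
    (hY : SmoothAt Y x) (h : ∀ᶠ y in 𝓝 x, X y = Y y) : Φ X = Φ Y := by
  classical
  let ψ (y : M) : ℝ := if X y = Y y then 1 else 0
  have hψx : ψ x = 1 := by simp [ψ, h.self_of_nhds]
  have e : ψ • X = ψ • Y := by
    ext1 y
    change ψ y • X y = ψ y • Y y
    dsimp [ψ]
    split_ifs with hy <;> simp [hy]
  have hψ : FunSmoothAt (n := n) ψ x := by
    have : FunSmoothAt (n := n) (fun _ : M => (1 : ℝ)) x := contMDiffAt_const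
    exact this.congr_of_eventuallyEq (h.mono fun y hy => by simp [ψ, hy])
  have h1 := hΦ.smul hψ hX
  rw [e, hΦ.smul hψ hY, hψx, one_smul, one_smul] at h1
  exact h1.symm

theorem sum (hΦ : IsSmoothTensorial Φ x) {ι : Type*} (s : Finset ι) (X : ι → VField n M)
    (hX : ∀ i, SmoothAt (X i) x) : Φ (fun y => ∑ i ∈ s, X i y) = ∑ i ∈ s, Φ (X i) := by
  classical
  induction s using Finset.induction_on with
  | empty =>
    have h0 : SmoothAt (0 : VField n M) x := by
      exact (SmoothAt.smul (n := n) (f := fun _ => (0 : ℝ)) contMDiffAt_const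
        (smoothAt_extend x 0)).congr (Filter.Eventually.of_forall fun y => by simp)
    have := hΦ.smul (f := fun _ => (0 : ℝ)) contMDiffAt_const h0
    simpa using! this
  | insert a s ha h =>
    simp only [Finset.sum_insert ha, ← h]
    exact hΦ.add (hX a) (SmoothAt.sum hX)

/-- A tensorial operation depends only on the value of the vector field at the point. -/
theorem pointwise (hΦ : IsSmoothTensorial Φ x) {X Y : VField n M} (hX : SmoothAt X x)
    (hY : SmoothAt Y x) (h : X x = Y x) : Φ X = Φ Y := by
  let t := trivializationAt (EuclideanSpace ℝ (Fin n)) (TangentSpace (𝓡 n) : M → Type _) x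
  have x_mem : x ∈ t.baseSet := FiberBundle.mem_baseSet_trivializationAt _ _ x
  let b := Module.Basis.ofVectorSpace ℝ (EuclideanSpace ℝ (Fin n))
  let s := t.localFrame b
  let c := t.localFrameCoeff (𝓡 n) b
  have hs (i) : SmoothAt (s i) x := contMDiffAt_localFrame_of_mem (I := 𝓡 n) ∞ _ b i x_mem
  have hc {Z : VField n M} (hZ : SmoothAt Z x) (i) :
      FunSmoothAt (n := n) (fun y => c i y (Z y)) x :=
    contMDiffAt_localFrameCoeff b x_mem hZ i
  -- Expanding in a local frame leaves only the coefficients of Z at x.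
  have key {Z : VField n M} (hZ : SmoothAt Z x) :
      Φ Z = ∑ i, c i x (Z x) • Φ (s i) := by
    rw [hΦ.congr hZ (SmoothAt.sum (s := Finset.univ) (X := fun i => (fun y => c i y (Z y)) • s i)
      fun i => SmoothAt.smul (hc hZ i) (hs i)) (t.eventually_eq_localFrame_sum_coeff_smul b x_mem),
      hΦ.sum _ _ fun i => SmoothAt.smul (hc hZ i) (hs i)]
    exact Finset.sum_congr rfl fun i _ => hΦ.smul (hc hZ i) (hs i)
  rw [key hX, key hY, h]

end IsSmoothTensorial
end Tensor

/-! ### Tensoriality of the curvature; Ricci as a basis-free trace. -/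

section Curvature
variable {n : ℕ} {M : Type*} [TopologicalSpace M] [ChartedSpace (EuclideanSpace ℝ (Fin n)) M]
  [IsManifold (𝓡 n) ∞ M]

namespace IsSmoothTensorial
variable {A : Type*} [AddCommGroup A] [Module ℝ A] {Φ : VField n M → A} {x : M}

/-- The linear map on the tangent space given by a tensorial operation. -/
def toLinearMap (hΦ : IsSmoothTensorial Φ x) : TangentSpace (𝓡 n) x →ₗ[ℝ] A where
  toFun v := Φ (FiberBundle.extend (EuclideanSpace ℝ (Fin n)) v)
  map_add' u v := by
    rw [← hΦ.add (smoothAt_extend x u) (smoothAt_extend x v)]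
    exact hΦ.pointwise (smoothAt_extend x _)
      (SmoothAt.add (smoothAt_extend x u) (smoothAt_extend x v)) (by simp)
  map_smul' c v := by
    have := hΦ.smul (f := fun _ => c) contMDiffAt_const (smoothAt_extend x v)
    rw [RingHom.id_apply, ← this]
    exact hΦ.pointwise (smoothAt_extend x _)
      (SmoothAt.smul contMDiffAt_const (smoothAt_extend x v)) (by simp)

end IsSmoothTensorial

variable (D : Connection n M)

theorem Connection.smul_apply {f : M → ℝ} {Y : VField n M} {x : M} (hf : FunDiffAt (n := n) f x)
    (hY : DiffAt Y x) (v : TangentSpace (𝓡 n) x) :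
    D (f • Y) x v = f x • D Y x v + mvfderiv (𝓡 n) f x v • Y x := by
  rw [D.isCovariantDerivativeOnUniv.leibniz hY hf]
  simp

theorem Connection.add_apply {Y Z : VField n M} {x : M}
    (hY : DiffAt Y x) (hZ : DiffAt Z x) (v : TangentSpace (𝓡 n) x) :
    D (Y + Z) x v = D Y x v + D Z x v := by
  rw [D.isCovariantDerivativeOnUniv.add hY hZ]
  simp

variable {D}

theorem curvature_swap (X Y Z : VField n M) (x : M) :
    curvature D X Y Z x = - curvature D Y X Z x := by
  simp only [curvature]
  rw [VectorField.mlieBracket_swap_apply, map_neg]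
  abel

theorem isSmoothTensorial_curvature_left (hD : D.IsSmooth) {Y Z : VField n M} {x : M}
    (hZ : SmoothAt Z x) : IsSmoothTensorial (fun X => curvature D X Y Z x) x where
  smul {f X} hf hX := by
    have e : D.along (f • X) Z = f • D.along X Z := by
      ext1 y; simp [Connection.along]
    simp only [curvature]
    rw [e, D.smul_apply hf.diffAt (hD x X Z hX hZ).diffAt,
      VectorField.mlieBracket_smul_left hf.diffAt hX.diffAt]
    simp only [Pi.smul_apply', map_smul, map_add, map_neg, neg_smul, Connection.along]
    module
  add {X X'} hX hX' := by
    have e : D.along (X + X') Z = D.along X Z + D.along X' Z := by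
      ext1 y; simp [Connection.along]
    simp only [curvature]
    rw [e, D.add_apply (hD x X Z hX hZ).diffAt (hD x X' Z hX' hZ).diffAt,
      VectorField.mlieBracket_add_left hX.diffAt hX'.diffAt]
    simp only [Pi.add_apply, map_add]
    module

theorem isSmoothTensorial_curvature_middle (hD : D.IsSmooth) {X Z : VField n M} {x : M}
    (hZ : SmoothAt Z x) : IsSmoothTensorial (fun Y => curvature D X Y Z x) x where
  smul {f Y} hf hY := by
    rw [curvature_swap, (isSmoothTensorial_curvature_left hD hZ).smul hf hY, curvature_swap,
        smul_neg,
      neg_neg]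
  add {Y Y'} hY hY' := by
    rw [curvature_swap, (isSmoothTensorial_curvature_left hD hZ).add hY hY', curvature_swap Y,
      curvature_swap Y']
    abel

/-- The mixed first-order terms cancel by antisymmetry in X and Y, and the second derivatives of f
occur only as XYf - YXf - [X,Y]f, which vanishes by `dirDeriv_commutator`. -/
theorem isSmoothTensorial_curvature_right (hD : D.IsSmooth) {X Y : VField n M} {x : M}
    (hX : SmoothAt X x) (hY : SmoothAt Y x) :
    IsSmoothTensorial (fun Z => curvature D X Y Z x) x where
  smul {f Z} hf hZ := by
    have e {V : VField n M} (hV : SmoothAt V x) (v : TangentSpace (𝓡 n) x) :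
        D (D.along V (f • Z)) x v
          = f x • D (D.along V Z) x v + mvfderiv (𝓡 n) f x v • D Z x (V x)
            + (dirDeriv V f x • D Z x v + mvfderiv (𝓡 n) (dirDeriv V f) x v • Z x) := by
      have h1 : ∀ᶠ y in 𝓝 x, D.along V (f • Z) y = (f • D.along V Z + dirDeriv V f • Z) y := by
        filter_upwards [hf.eventually_diffAt, hZ.eventually_diffAt] with y h1 h2
        simp only [Connection.along, D.smul_apply h1 h2]
        rfl
      have s1 := SmoothAt.smul hf (hD x V Z hV hZ)
      have s2 := SmoothAt.smul (hf.dirDeriv hV) hZ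
      rw [D.congr_of_eventually (hD x V _ hV (SmoothAt.smul hf hZ)).diffAt (s1.add s2).diffAt h1,
        D.add_apply s1.diffAt s2.diffAt, D.smul_apply hf.diffAt (hD x V Z hV hZ).diffAt,
        D.smul_apply (hf.dirDeriv hV).diffAt hZ.diffAt]
      rfl
    simp only [curvature]
    rw [e hX, e hY, D.smul_apply hf.diffAt hZ.diffAt]
    have := dirDeriv_commutator hf hX hY
    simp only [dirDeriv] at this ⊢
    rw [← this]
    module
  add {Z Z'} hZ hZ' := by
    have e {V : VField n M} (hV : SmoothAt V x) (v : TangentSpace (𝓡 n) x) :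
        D (D.along V (Z + Z')) x v = D (D.along V Z) x v + D (D.along V Z') x v := by
      have h1 : ∀ᶠ y in 𝓝 x, D.along V (Z + Z') y = (D.along V Z + D.along V Z') y := by
        filter_upwards [hZ.eventually_diffAt, hZ'.eventually_diffAt] with y h1 h2
        simp only [Connection.along, D.add_apply h1 h2]
        rfl
      have s1 := hD x V Z hV hZ
      have s2 := hD x V Z' hV hZ'
      rw [D.congr_of_eventually (hD x V _ hV (hZ.add hZ')).diffAt (s1.add s2).diffAt h1,
        D.add_apply s1.diffAt s2.diffAt]
    simp only [curvature]
    rw [e hX, e hY, D.add_apply hZ.diffAt hZ'.diffAt]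
    module

/-- The curvature of smooth fields at a point only depends on their values at the point. -/
theorem curvature_eq_curvatureAt (hD : D.IsSmooth) {X Y Z : VField n M} {x : M}
    (hX : SmoothAt X x) (hY : SmoothAt Y x) (hZ : SmoothAt Z x) :
    curvature D X Y Z x = curvatureAt D x (X x) (Y x) (Z x) := by
  have hX' := smoothAt_extend x (X x)
  have hY' := smoothAt_extend x (Y x)
  have hZ' := smoothAt_extend x (Z x)
  rw [(isSmoothTensorial_curvature_left hD hZ).pointwise hX hX' (by simp),
    (isSmoothTensorial_curvature_middle hD hZ).pointwise hY hY' (by simp),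
    (isSmoothTensorial_curvature_right hD hX' hY').pointwise hZ hZ' (by simp)]
  rfl

theorem curvatureAt_swap (x : M) (u v w : TangentSpace (𝓡 n) x) :
    curvatureAt D x u v w = - curvatureAt D x v u w :=
  curvature_swap _ _ _ x

/-- The linear map `u ↦ R(u, v) w`. -/
def curvatureMap (hD : D.IsSmooth) (x : M) (v w : TangentSpace (𝓡 n) x) :
    TangentSpace (𝓡 n) x →ₗ[ℝ] TangentSpace (𝓡 n) x :=
  (isSmoothTensorial_curvature_left hD (smoothAt_extend x w)
    (Y := FiberBundle.extend (EuclideanSpace ℝ (Fin n)) v)).toLinearMap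

theorem curvatureMap_apply (hD : D.IsSmooth) (x : M) (u v w : TangentSpace (𝓡 n) x) :
    curvatureMap hD x v w u = curvatureAt D x u v w := rfl

theorem curvatureAt_smul_left (hD : D.IsSmooth) (x : M) (c : ℝ) (u v w : TangentSpace (𝓡 n) x) :
    curvatureAt D x (c • u) v w = c • curvatureAt D x u v w :=
  (curvatureMap hD x v w).map_smul c u

theorem curvatureAt_add_right (hD : D.IsSmooth) (x : M) (u v w w' : TangentSpace (𝓡 n) x) :
    curvatureAt D x u v (w + w') = curvatureAt D x u v w + curvatureAt D x u v w' :=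
  (isSmoothTensorial_curvature_right hD (smoothAt_extend x u)
    (smoothAt_extend x v)).toLinearMap.map_add w w'

theorem ricci_eq_trace (hD : D.IsSmooth) (x : M) (v w : TangentSpace (𝓡 n) x) :
    ricci D x v w = LinearMap.trace ℝ (TangentSpace (𝓡 n) x) (curvatureMap hD x v w) := by
  rw [LinearMap.trace_eq_matrix_trace ℝ (tangentBasis x), Matrix.trace]
  simp only [ricci, Matrix.diag, LinearMap.toMatrix_apply, curvatureMap_apply]

end Curvature

/-! ### Algebraic symmetries of the Levi-Civita curvature. -/

section LeviCivita
variable {n : ℕ} {M : Type*} [TopologicalSpace M] [ChartedSpace (EuclideanSpace ℝ (Fin n)) M]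
  [IsManifold (𝓡 n) ∞ M] {g : LorentzMetric n M} {nabla : Connection n M}

theorem LorentzMetric.smooth_apply (g : LorentzMetric n M) {Y Z : VField n M} {x : M}
    (hY : SmoothAt Y x) (hZ : SmoothAt Z x) :
    FunSmoothAt (n := n) (fun y => g.val y (Y y) (Z y)) x := by
  have h := ContMDiffAt.clm_bundle_apply₂ (IB := 𝓡 n) (n := ∞)
    (F₁ := EuclideanSpace ℝ (Fin n)) (E₁ := (TangentSpace (𝓡 n) : M → Type _))
    (F₂ := EuclideanSpace ℝ (Fin n)) (E₂ := (TangentSpace (𝓡 n) : M → Type _))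
    (F₃ := ℝ) (E₃ := fun _ : M => ℝ) (IM := 𝓡 n) (b := id) (x := x)
    (ψ := g.val) (v := Y) (w := Z) (g.smooth x) hY hZ
  rw [Bundle.contMDiffAt_totalSpace] at h
  simpa using! h.2

theorem IsLeviCivita.bracket (h : IsLeviCivita g nabla) {X Y : VField n M} {x : M}
    (hX : DiffAt X x) (hY : DiffAt Y x) :
    nabla Y x (X x) = nabla X x (Y x) + VectorField.mlieBracket (𝓡 n) X Y x := by
  rw [← (nabla.torsion_eq_zero_iff).1 h.torsion_free hX hY]
  abel

theorem IsLeviCivita.bianchi (h : IsLeviCivita g nabla) (x : M) (u v w : TangentSpace (𝓡 n) x) :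
    curvatureAt nabla x u v w + curvatureAt nabla x v w u + curvatureAt nabla x w u v = 0 := by
  -- Vanishing torsion is used twice: inside, to exchange Y and Z, and outside, to exchange X and
  -- [Y,Z]. In the cyclic sum only double brackets survive, and these cancel by Jacobi.
  have key : ∀ {X Y Z : VField n M}, SmoothAt X x → SmoothAt Y x → SmoothAt Z x →
      nabla (nabla.along Y Z) x (X x) = nabla (nabla.along Z Y) x (X x)
        + nabla X x (VectorField.mlieBracket (𝓡 n) Y Z x)
        + VectorField.mlieBracket (𝓡 n) X (VectorField.mlieBracket (𝓡 n) Y Z) x := by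
    intro X Y Z hX hY hZ
    have e : ∀ᶠ y in 𝓝 x, nabla.along Y Z y
        = (nabla.along Z Y + VectorField.mlieBracket (𝓡 n) Y Z) y := by
      filter_upwards [hY.eventually_diffAt, hZ.eventually_diffAt] with y h1 h2
      exact h.bracket h1 h2
    have s1 := h.smooth x Z Y hZ hY
    have s2 := smooth_lieBracket hY hZ
    rw [nabla.congr_of_eventually (h.smooth x Y Z hY hZ).diffAt (s1.add s2).diffAt e,
      nabla.add_apply s1.diffAt s2.diffAt, h.bracket hX.diffAt s2.diffAt, add_assoc]
  have hX := smoothAt_extend x u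
  have hY := smoothAt_extend x v
  have hZ := smoothAt_extend x w
  have J := jacobi hX hY hZ
  set X := FiberBundle.extend (EuclideanSpace ℝ (Fin n)) u
  set Y := FiberBundle.extend (EuclideanSpace ℝ (Fin n)) v
  set Z := FiberBundle.extend (EuclideanSpace ℝ (Fin n)) w
  have n1 : VectorField.mlieBracket (𝓡 n) Z X x = - VectorField.mlieBracket (𝓡 n) X Z x :=
    VectorField.mlieBracket_swap_apply
  have n2 : VectorField.mlieBracket (𝓡 n) Y (VectorField.mlieBracket (𝓡 n) Z X) x
      = - VectorField.mlieBracket (𝓡 n) Y (VectorField.mlieBracket (𝓡 n) X Z) x := by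
    rw [VectorField.mlieBracket_swap (V := Z) (W := X)]
    have := VectorField.mlieBracket_const_smul_right (V := Y) (c := (-1 : ℝ))
      (smooth_lieBracket hX hZ).diffAt
    simpa using! this
  have n3 : VectorField.mlieBracket (𝓡 n) Z (VectorField.mlieBracket (𝓡 n) X Y) x
      = - VectorField.mlieBracket (𝓡 n) (VectorField.mlieBracket (𝓡 n) X Y) Z x :=
    VectorField.mlieBracket_swap_apply
  change curvature nabla X Y Z x + curvature nabla Y Z X x + curvature nabla Z X Y x = 0
  simp only [curvature]
  rw [key hX hY hZ, key hY hZ hX, key hZ hX hY, n2, n3, J]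
  abel

/-- Metric compatibility expresses XYf - YXf - [X,Y]f, with f = g(Z,Z), as 2 g(R(X,Y)Z, Z); the
former is zero. -/
theorem IsLeviCivita.metric_curvature_self (h : IsLeviCivita g nabla) (x : M)
    (u v w : TangentSpace (𝓡 n) x) : g.val x (curvatureAt nabla x u v w) w = 0 := by
  have hX := smoothAt_extend x u
  have hY := smoothAt_extend x v
  have hZ := smoothAt_extend x w
  have hZx : FiberBundle.extend (EuclideanSpace ℝ (Fin n)) w x = w := by simp
  change g.val x (curvature nabla (FiberBundle.extend (EuclideanSpace ℝ (Fin n)) u)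
    (FiberBundle.extend (EuclideanSpace ℝ (Fin n)) v)
    (FiberBundle.extend (EuclideanSpace ℝ (Fin n)) w) x) w = 0
  rw [← hZx]
  simp only [FiberBundle.extend_apply_self]
  set X := FiberBundle.extend (EuclideanSpace ℝ (Fin n)) u
  set Y := FiberBundle.extend (EuclideanSpace ℝ (Fin n)) v
  set Z := FiberBundle.extend (EuclideanSpace ℝ (Fin n)) w
  set f : M → ℝ := fun y => g.val y (Z y) (Z y) with hf
  have sf : FunSmoothAt (n := n) f x := g.smooth_apply hZ hZ
  have first : ∀ {U : VField n M} {y : M}, DiffAt Z y →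
      dirDeriv U f y = 2 * g.val y (nabla.along U Z y) (Z y) := by
    intro U y hy
    rw [dirDeriv, h.metric y Z Z hy hy, g.symm y (Z y)]
    simp only [Connection.along]
    ring
  have second : ∀ {U V : VField n M}, SmoothAt U x → SmoothAt V x →
      dirDeriv U (dirDeriv V f) x = 2 * (g.val x (nabla (nabla.along V Z) x (U x)) (Z x)
        + g.val x (nabla Z x (V x)) (nabla Z x (U x))) := by
    intro U V hU hV
    have hVZ := h.smooth x V Z hV hZ
    have e : dirDeriv V f =ᶠ[𝓝 x] fun y => 2 * g.val y (nabla.along V Z y) (Z y) := by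
      filter_upwards [hZ.eventually_diffAt] with y hy
      exact first hy
    have e2 : mvfderiv (𝓡 n) (dirDeriv V f) x
        = mvfderiv (𝓡 n) (fun y => 2 * g.val y (nabla.along V Z y) (Z y)) x := by
      simp only [mvfderiv, e.mfderiv_eq]
      rw [e.self_of_nhds]
    have e3 := mvfderiv_mul (I := 𝓡 n) (x := x) (f := fun _ : M => (2 : ℝ))
      (g := fun y => g.val y (nabla.along V Z y) (Z y)) mdifferentiableAt_const
      (g.smooth_apply hVZ hZ).diffAt
    have e4 := congrArg (fun L => L (U x)) e3
    have e5 := h.metric x _ Z hVZ.diffAt hZ.diffAt (U x)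
    rw [dirDeriv, e2]
    refine Eq.trans e4 ?_
    simp only [mvfderiv_const, smul_zero, add_zero]
    exact congrArg (fun r => 2 * r) e5
  have C := dirDeriv_commutator sf hX hY
  rw [second hX hY, second hY hX, first hZ.diffAt, g.symm x (nabla Z x (Y x))] at C
  simp only [Connection.along] at C
  simp only [curvature, map_sub, sub_apply]
  rw [hZx] at C
  linarith

theorem IsLeviCivita.metric_curvature_swap (h : IsLeviCivita g nabla) (x : M)
    (u v w z : TangentSpace (𝓡 n) x) :
    g.val x (curvatureAt nabla x u v w) z = - g.val x (curvatureAt nabla x u v z) w := by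
  have h1 := h.metric_curvature_self x u v (w + z)
  rw [curvatureAt_add_right h.smooth] at h1
  simp only [map_add, add_apply, h.metric_curvature_self] at h1
  linarith

/-- A linear combination of the first Bianchi identity for the four cyclic orders of a, b, c, d and
the antisymmetries in the first and the last pair. -/
theorem IsLeviCivita.metric_curvature_pair (h : IsLeviCivita g nabla) (x : M)
    (a b c d : TangentSpace (𝓡 n) x) :
    g.val x (curvatureAt nabla x a b c) d = g.val x (curvatureAt nabla x c d a) b := by
  have B (u v w z : TangentSpace (𝓡 n) x) : g.val x (curvatureAt nabla x u v w) z
      + g.val x (curvatureAt nabla x v w u) z + g.val x (curvatureAt nabla x w u v) z = 0 := by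
    have := congrArg (fun y => g.val x y z) (h.bianchi x u v w)
    simpa using! this
  have A (u v w z : TangentSpace (𝓡 n) x) : g.val x (curvatureAt nabla x u v w) z
      = - g.val x (curvatureAt nabla x v u w) z := by
    rw [curvatureAt_swap]; simp
  have S := h.metric_curvature_swap x
  linarith [B a b c d, B b c d a, B c d a b, B d a b c, A a b c d, A b c d a, A c d a b, A d a b c,
    A a c b d, A b d c a, A a b d c, A c d b a, A a d b c, A b c a d, A c a b d, A d b a c,
    S a b c d, S b c a d, S c a b d, S b c d a, S c d b a, S d b c a, S c d a b, S d a c b, S a c d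
        b,
    S d a b c, S a b d c, S b d a c, A a c d b, A d b c a]

/-! ### Coordinate vector fields of a chart. -/

theorem smooth_constField {E : Type*} [NormedAddCommGroup E] [NormedSpace ℝ E] (a z : E) :
    ContMDiffAt 𝓘(ℝ, E) 𝓘(ℝ, E).tangent ∞ (fun w => (⟨w, a⟩ : TangentBundle 𝓘(ℝ, E) E)) z :=
  contMDiffAt_vectorSpace_iff_contDiffAt.2 contDiffAt_const

theorem lieBracket_constField {E : Type*} [NormedAddCommGroup E] [NormedSpace ℝ E] (a b z : E) :
    VectorField.mlieBracket 𝓘(ℝ, E) (fun _ : E => (a : E)) (fun _ : E => (b : E)) z = 0 := by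
  have h1 (V W : Π z : E, TangentSpace 𝓘(ℝ, E) z) : VectorField.mlieBracket 𝓘(ℝ, E) V W z
      = VectorField.lieBracketWithin ℝ V W Set.univ z := by
    rw [← VectorField.mlieBracketWithin_univ, VectorField.mlieBracketWithin_eq_lieBracketWithin]
  refine (h1 (fun _ => (a : E)) (fun _ => (b : E))).trans ?_
  simp [VectorField.lieBracketWithin]
  rfl

/-- The differential of `φ` inverted on the constant vector `a`: a coordinate vector field. -/
def coordField (φ : OpenPartialHomeomorph M (EuclideanSpace ℝ (Fin n))) (a : EuclideanSpace ℝ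
    (Fin n)) :
    VField n M :=
  VectorField.mpullback (𝓡 n) 𝓘(ℝ, EuclideanSpace ℝ (Fin n)) φ (fun _ => a)

variable {φ : OpenPartialHomeomorph M (EuclideanSpace ℝ (Fin n))}

theorem mfderiv_isInvertible (hφ : φ ∈ IsManifold.maximalAtlas (𝓡 n) ∞ M) {y : M}
    (hy : y ∈ φ.source) :
    (mfderiv (𝓡 n) 𝓘(ℝ, EuclideanSpace ℝ (Fin n)) φ y).IsInvertible := by
  have hd : φ.MDifferentiable (𝓡 n) 𝓘(ℝ, EuclideanSpace ℝ (Fin n)) :=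
    ⟨(contMDiffOn_of_mem_maximalAtlas hφ).mdifferentiableOn (by simp),
      (contMDiffOn_symm_of_mem_maximalAtlas hφ).mdifferentiableOn (by simp)⟩
  exact ⟨hd.mfderiv hy, rfl⟩

theorem smoothAt_coordField (hφ : φ ∈ IsManifold.maximalAtlas (𝓡 n) ∞ M) {y : M}
    (hy : y ∈ φ.source) (a : EuclideanSpace ℝ (Fin n)) : SmoothAt (coordField φ a) y := by
  refine ContMDiffAt.mpullback_vectorField_preimage (n := ∞) (m := ∞) ?_
    (contMDiffAt_of_mem_maximalAtlas hφ hy) (mfderiv_isInvertible hφ hy) (by simp)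
  exact smooth_constField a (φ y)

theorem mfderiv_coordField (hφ : φ ∈ IsManifold.maximalAtlas (𝓡 n) ∞ M) {y : M}
    (hy : y ∈ φ.source) (a : EuclideanSpace ℝ (Fin n)) :
    mfderiv (𝓡 n) 𝓘(ℝ, EuclideanSpace ℝ (Fin n)) φ y (coordField φ a y) = a := by
  exact (mfderiv_isInvertible hφ hy).self_apply_inverse a

theorem lieBracket_coordField (hφ : φ ∈ IsManifold.maximalAtlas (𝓡 n) ∞ M) {y : M}
    (hy : y ∈ φ.source) (a b : EuclideanSpace ℝ (Fin n)) :
    VectorField.mlieBracket (𝓡 n) (coordField φ a) (coordField φ b) y = 0 := by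
  have : IsManifold (𝓡 n) (minSmoothness ℝ 2) M := by
    simp only [minSmoothness_of_isRCLikeNormedField]
    exact IsManifold.of_le (n := ∞) two_le_infty
  have h := VectorField.mpullback_mlieBracket (I := 𝓡 n) (I' := 𝓘(ℝ, EuclideanSpace ℝ (Fin n)))
    (f := φ) (x₀ := y) (V := fun _ => a) (W := fun _ => b) 
    ((smooth_constField a _).mdifferentiableAt (by simp))
    ((smooth_constField b _).mdifferentiableAt (by simp))
    (contMDiffAt_of_mem_maximalAtlas hφ hy)
    (by simp only [minSmoothness_of_isRCLikeNormedField]; exact two_le_infty)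
  unfold coordField
  rw [← h, VectorField.mpullback_apply]
  exact (congrArg _ (lieBracket_constField a b (φ y))).trans (map_zero _)

end LeviCivita

/-! ### Nondegeneracy of the metric and the trace of Einstein's equations. -/

section Einstein
variable {n : ℕ} {M : Type*} [TopologicalSpace M] [ChartedSpace (EuclideanSpace ℝ (Fin n)) M]
  [IsManifold (𝓡 n) ∞ M] {g : LorentzMetric n M} {nabla : Connection n M}

/-- A vector orthogonal to everything is orthogonal to a timelike vector, so if it were non-zero the
signature would make it spacelike, although it is orthogonal to itself. -/
theorem LorentzMetric.eq_zero_of_orthogonal (g : LorentzMetric n M) {x : M} {v : TangentSpace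
    (𝓡 n) x}
    (h : ∀ w, g.val x w v = 0) : v = 0 := by
  by_contra hv
  obtain ⟨t, -, ht⟩ := g.signature x
  exact (ht v (h t) hv).ne' (h v)

/-- The Gram matrix of the metric. -/
def gramMatrix (g : LorentzMetric n M) (x : M) : Matrix (Fin n) (Fin n) ℝ :=
  Matrix.of fun k l => g.val x (tangentBasis x k) (tangentBasis x l)

theorem det_gramMatrix_ne_zero (g : LorentzMetric n M) (x : M) : (gramMatrix g x).det ≠ 0 := by
  intro h
  obtain ⟨c, hc, h0⟩ := Matrix.exists_mulVec_eq_zero_iff.2 h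
  apply hc
  set u := ∑ l, c l • tangentBasis x l with hu
  have h1 : ∀ k, g.val x (tangentBasis x k) u = 0 := by
    intro k
    have := congrFun h0 k
    simp only [Matrix.mulVec, dotProduct, gramMatrix, Matrix.of_apply, Pi.zero_apply] at this
    rw [hu, map_sum, ← this]
    exact Finset.sum_congr rfl fun l _ => by rw [map_smul, smul_eq_mul, mul_comm]
  have h2 : u = 0 := by
    apply g.eq_zero_of_orthogonal
    intro w
    rw [← (tangentBasis x).sum_repr w, g.symm, map_sum]
    refine Finset.sum_eq_zero fun k _ => ?_
    rw [map_smul, g.symm, h1, smul_zero]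
  funext l
  have := (tangentBasis x).repr_sum_self c
  rw [← hu, h2] at this
  simpa using (congrFun this l).symm

theorem sum_inv_gramMatrix (g : LorentzMetric n M) (x : M) :
    ∑ i, ∑ j, (gramMatrix g x)⁻¹ i j * g.val x (tangentBasis x i) (tangentBasis x j) = n := by
  have h1 : ((gramMatrix g x)⁻¹ * gramMatrix g x).trace = n := by
    rw [Matrix.nonsing_inv_mul _ (isUnit_iff_ne_zero.2 (det_gramMatrix_ne_zero g x))]
    simp
  rw [← h1]
  simp only [Matrix.trace, Matrix.diag, Matrix.mul_apply, gramMatrix, Matrix.of_apply]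
  refine Finset.sum_congr rfl fun i _ => Finset.sum_congr rfl fun j _ => ?_
  rw [g.symm x]

/-- The equations read Ric = (R/2 - Λ) g. Their trace R = n (R/2 - Λ) determines R because n ≠ 2, so
the factor depends on n and Λ only and is common to both space-times. -/
theorem ricci_eq_of_vacuum (hn : 2 < n) {Λ : ℝ} {S : Set M} (h : VacuumEinsteinOn g nabla Λ S)
    {x : M}
    (hx : x ∈ S) (u v : TangentSpace (𝓡 n) x) :
    ricci nabla x u v = 2 * Λ / (n - 2) * g.val x u v := by
  set R := scalarCurvature g nabla x with hR
  have h1 : ∀ u v, ricci nabla x u v = (R / 2 - Λ) * g.val x u v := by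
    intro u v
    have := h x hx u v
    rw [einstein, ← hR] at this
    linarith
  have h2 : R = (R / 2 - Λ) * n := by
    rw [← sum_inv_gramMatrix g x, Finset.mul_sum]
    conv_lhs => rw [hR, scalarCurvature]
    refine Finset.sum_congr rfl fun i _ => ?_
    rw [Finset.mul_sum]
    refine Finset.sum_congr rfl fun j _ => ?_
    rw [h1, gramMatrix]
    ring
  have hn' : (2 : ℝ) < n := by exact_mod_cast hn
  have h3 : (n : ℝ) - 2 ≠ 0 := by linarith
  have h4 : R / 2 - Λ = 2 * Λ / (n - 2) := by
    field_simp
    linarith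
  rw [h1, h4]

end Einstein

/-! ### Two trace formulas in linear algebra. -/

section Trace

/-- The trace of an endomorphism preserving the image of an injective map of corank one. -/
theorem trace_eq_trace_add_of_intertwines {V W : Type*} [AddCommGroup V] [Module ℝ V]
    [FiniteDimensional ℝ V] [AddCommGroup W] [Module ℝ W] [FiniteDimensional ℝ W]
    (P : W →ₗ[ℝ] V) (hP : Function.Injective P) (φ : V →ₗ[ℝ] ℝ)
        (hφ : LinearMap.ker φ = LinearMap.range P)
    {k : V} (hk : φ k = 1) (A : V →ₗ[ℝ] V) (B : W →ₗ[ℝ] W) (hAB : ∀ w, A (P w) = P (B w)) :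
    LinearMap.trace ℝ V A = LinearMap.trace ℝ W B + φ (A k) := by
  have hφP (w : W) : φ (P w) = 0 := by
    have : P w ∈ LinearMap.ker φ := hφ ▸ LinearMap.mem_range_self P w
    exact this
  -- In the splitting V = P(W) ⊕ ℝk the form φ reads off the second coordinate and A is block
  -- triangular, with diagonal blocks B and φ(A k).
  let e : (W × ℝ) ≃ₗ[ℝ] V := LinearEquiv.ofBijective
    (P.coprod (LinearMap.toSpanSingleton ℝ V k)) (by
      constructor
      · rw [← LinearMap.ker_eq_bot, LinearMap.ker_eq_bot']
        rintro ⟨w, r⟩ h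
        simp only [LinearMap.coprod_apply, LinearMap.toSpanSingleton_apply] at h
        have h1 := congrArg φ h
        simp only [map_add, hφP, map_smul, hk, smul_eq_mul, mul_one, zero_add, map_zero] at h1
        subst h1
        simp only [zero_smul, add_zero] at h
        rw [Prod.mk_eq_zero]
        exact ⟨hP (h.trans (map_zero P).symm), rfl⟩
      · intro v
        have : v - φ v • k ∈ LinearMap.range P := by
          rw [← hφ]; simp [hk]
        obtain ⟨w, hw⟩ := this
        exact ⟨(w, φ v), by simp [hw]⟩)
  have he (w : W) (r : ℝ) : e (w, r) = P w + r • k := rfl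
  have hsnd (v : V) : (e.symm v).2 = φ v := by
    obtain ⟨⟨w, r⟩, rfl⟩ := e.surjective v
    rw [e.symm_apply_apply, he]
    simp [hφP, hk]
  let bW := Module.finBasis ℝ W
  let b := (bW.prod (Module.Basis.singleton Unit ℝ)).map e
  rw [LinearMap.trace_eq_matrix_trace ℝ b, LinearMap.trace_eq_matrix_trace ℝ bW, Matrix.trace,
    Matrix.trace, Fintype.sum_sum_type]
  congr 1
  · refine Finset.sum_congr rfl fun i _ => ?_
    have h1 : e.symm (P (B (bW i))) = (B (bW i), 0) := by
      rw [LinearEquiv.symm_apply_eq, he]; simp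
    simp only [Matrix.diag, LinearMap.toMatrix_apply, b, Module.Basis.map_apply,
      Module.Basis.prod_apply, Sum.elim_inl, Function.comp, LinearMap.coe_inl, he, zero_smul,
      add_zero, hAB, Module.Basis.map_repr, LinearEquiv.trans_apply, h1,
      Module.Basis.prod_repr_inl]
  · simp only [Matrix.diag, LinearMap.toMatrix_apply, b, Module.Basis.map_apply,
      Module.Basis.prod_apply, Sum.elim_inr, Function.comp, LinearMap.coe_inr, he,
          Module.Basis.singleton_apply,
      map_zero, zero_add, one_smul, Module.Basis.map_repr, LinearEquiv.trans_apply,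
      Module.Basis.prod_repr_inr]
    simp [hsnd]

/-- The trace of a linear map of rank one. -/
theorem trace_smul_vector {W : Type*} [AddCommGroup W] [Module ℝ W] [FiniteDimensional ℝ W]
    (B : W →ₗ[ℝ] W) {l : W} (hl : l ≠ 0) (h : ∀ u, ∃ c : ℝ, B u = c • l) {c : ℝ}
        (hc : B l = c • l) :
    LinearMap.trace ℝ W B = c := by
  obtain ⟨f, hf⟩ := Module.Projective.exists_dual_ne_zero ℝ hl
  have hB : B = ((f l)⁻¹ • f ∘ₗ B).smulRight l := by
    ext u
    obtain ⟨r, hr⟩ := h u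
    simp [hr]
    field_simp
  rw [hB, LinearMap.trace_smulRight]
  simp [hc]
  field_simp

end Trace

/-! ### Charts adapted to the surface, and extension of tangent fields. -/

section Adapted
variable {n : ℕ} {M : Type*} [TopologicalSpace M] [ChartedSpace (EuclideanSpace ℝ (Fin n)) M]
  [IsManifold (𝓡 n) ∞ M]
  {N : Type*} [TopologicalSpace N] [ChartedSpace (EuclideanSpace ℝ (Fin (n - 1))) N]
  [IsManifold (𝓡 (n - 1)) ∞ N] {ι : N → M} {p : N}

/-- Charts around `p` and `ι p` in which `ι` is the linear map `L`, with left inverse `π`. -/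
structure SliceCharts (n : ℕ) {M : Type*} [TopologicalSpace M]
    [ChartedSpace (EuclideanSpace ℝ (Fin n)) M]
    {N : Type*} [TopologicalSpace N] [ChartedSpace (EuclideanSpace ℝ (Fin (n - 1))) N]
    (ι : N → M) (p : N) where
  /-- the chart of the surface -/
  dom : OpenPartialHomeomorph N (EuclideanSpace ℝ (Fin (n - 1)))
  /-- the chart of the space-time -/
  cod : OpenPartialHomeomorph M (EuclideanSpace ℝ (Fin n))
  /-- the map `ι` in the charts -/
  L : EuclideanSpace ℝ (Fin (n - 1)) →L[ℝ] EuclideanSpace ℝ (Fin n)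
  /-- a left inverse of `L` -/
  π : EuclideanSpace ℝ (Fin n) →L[ℝ] EuclideanSpace ℝ (Fin (n - 1))
  dom_mem : dom ∈ IsManifold.maximalAtlas (𝓡 (n - 1)) ∞ N
  cod_mem : cod ∈ IsManifold.maximalAtlas (𝓡 n) ∞ M
  mem_dom : p ∈ dom.source
  mem_cod : ∀ y ∈ dom.source, ι y ∈ cod.source
  apply : ∀ y ∈ dom.source, cod (ι y) = L (dom y)
  left_inv : ∀ a, π (L a) = a

theorem exists_sliceCharts
    (hι : Manifold.IsSmoothEmbedding (𝓡 (n - 1)) (𝓡 n) ∞ ι) (p : N) :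
    Nonempty (SliceCharts n ι p) := by
  have h := hι.isImmersion.isImmersionAt p
  refine ⟨⟨h.domChart, h.codChart,
    h.equiv.toContinuousLinearMap ∘L ContinuousLinearMap.inl ℝ _ _,
    ContinuousLinearMap.fst ℝ _ _ ∘L h.equiv.symm.toContinuousLinearMap,
    h.domChart_mem_maximalAtlas, h.codChart_mem_maximalAtlas, h.mem_domChart_source,
    fun y hy => h.source_subset_preimage_source hy, fun y hy => ?_, fun a => by simp⟩⟩
  have h1 := h.writtenInCharts
    (show h.domChart.extend (𝓡 (n - 1)) y ∈ _ from by simp [h.domChart.map_source hy])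
  simpa [h.domChart.left_inv hy] using h1

variable (s : SliceCharts n ι p)

namespace SliceCharts

theorem eventually_mem : ∀ᶠ y in 𝓝 p, y ∈ s.dom.source :=
  s.dom.open_source.mem_nhds s.mem_dom

/-- The coordinate fields of the surface. -/
def field (a : EuclideanSpace ℝ (Fin (n - 1))) : VField (n - 1) N := coordField s.dom a

/-- The coordinate fields of the space-time which extend those of the surface. -/
def field' (a : EuclideanSpace ℝ (Fin (n - 1))) : VField n M := coordField s.cod (s.L a)

theorem mfderiv_cod_push (hι : ContMDiff (𝓡 (n - 1)) (𝓡 n) ∞ ι) {y : N} (hy : y ∈ s.dom.source)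
    (u : TangentSpace (𝓡 (n - 1)) y) :
    mfderiv (𝓡 n) 𝓘(ℝ, EuclideanSpace ℝ (Fin n)) s.cod (ι y) (push ι y u)
      = s.L (mfderiv (𝓡 (n - 1)) 𝓘(ℝ, EuclideanSpace ℝ (Fin (n - 1))) s.dom y u) := by
  have d1 : MDifferentiableAt (𝓡 n) 𝓘(ℝ, EuclideanSpace ℝ (Fin n)) s.cod (ι y) :=
    (contMDiffAt_of_mem_maximalAtlas s.cod_mem (s.mem_cod y hy)).mdifferentiableAt (by simp)
  have d2 : MDifferentiableAt (𝓡 (n - 1)) (𝓡 n) ι y := (hι y).mdifferentiableAt (by simp)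
  have d3 : MDifferentiableAt (𝓡 (n - 1)) 𝓘(ℝ, EuclideanSpace ℝ (Fin (n - 1))) s.dom y :=
    (contMDiffAt_of_mem_maximalAtlas s.dom_mem hy).mdifferentiableAt (by simp)
  have e : (s.cod ∘ ι) =ᶠ[𝓝 y] (s.L ∘ s.dom) := by
    filter_upwards [s.dom.open_source.mem_nhds hy] with z hz
    exact s.apply z hz
  have h1 := mfderiv_comp_apply (I := 𝓡 (n - 1)) (I' := 𝓡 n) (I'' := 𝓘(ℝ, EuclideanSpace ℝ (Fin n)))
    y d1 d2 u
  have h2 := mfderiv_comp_apply (I := 𝓡 (n - 1)) (I' := 𝓘(ℝ, EuclideanSpace ℝ (Fin (n - 1))))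
    (I'' := 𝓘(ℝ, EuclideanSpace ℝ (Fin n))) y (s.L.mdifferentiableAt) d3 u
  rw [← h1]
  refine Eq.trans ?_ (h2.trans ?_)
  · exact congrArg (fun T : EuclideanSpace ℝ (Fin (n - 1)) →L[ℝ] EuclideanSpace ℝ (Fin n) => T u)
      e.mfderiv_eq
  · rw [ContinuousLinearMap.mfderiv_eq]
    rfl

/-- The chart differential sends both sides to L a. Since this holds on the whole chart domain, the
coordinate fields give extendable frames whose brackets vanish on the surface and in space-time
alike. -/
theorem push_field (hι : ContMDiff (𝓡 (n - 1)) (𝓡 n) ∞ ι) {y : N} (hy : y ∈ s.dom.source)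
    (a : EuclideanSpace ℝ (Fin (n - 1))) :
    s.field' a (ι y) = push ι y (s.field a y) := by
  obtain ⟨e, he⟩ := mfderiv_isInvertible s.cod_mem (s.mem_cod y hy)
  apply e.injective
  have h1 := mfderiv_coordField s.cod_mem (s.mem_cod y hy) (s.L a)
  have h2 := s.mfderiv_cod_push hι hy (s.field a y)
  have h3 := mfderiv_coordField s.dom_mem hy a
  rw [← he] at h1 h2
  exact h1.trans (h2.trans (congrArg s.L h3)).symm

theorem push_injective (s : SliceCharts n ι p) (hι : ContMDiff (𝓡 (n - 1))
    (𝓡 n) ∞ ι) : Function.Injective (push (n := n) ι p) := by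
  intro u v h
  have h1 := s.mfderiv_cod_push hι s.mem_dom u
  rw [h, s.mfderiv_cod_push hι s.mem_dom v] at h1
  have h2 := congrArg s.π h1
  replace h2 := (s.left_inv _).symm.trans (h2.trans (s.left_inv _))
  obtain ⟨e, he⟩ := mfderiv_isInvertible s.dom_mem s.mem_dom
  rw [← he] at h2
  exact (e.injective h2).symm

theorem smoothAt_field {y : N} (hy : y ∈ s.dom.source) (a : EuclideanSpace ℝ (Fin (n - 1))) :
    SmoothAt (s.field a) y :=
  smoothAt_coordField s.dom_mem hy a

theorem smoothAt_field' {y : N} (hy : y ∈ s.dom.source) (a : EuclideanSpace ℝ (Fin (n - 1))) :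
    SmoothAt (s.field' a) (ι y) :=
  smoothAt_coordField s.cod_mem (s.mem_cod y hy) _

theorem isExtensionAt_field (hι : ContMDiff (𝓡 (n - 1)) (𝓡 n) ∞ ι) {y : N} (hy : y ∈ s.dom.source)
    (a : EuclideanSpace ℝ (Fin (n - 1))) : IsExtensionAt ι y (s.field a) (s.field' a) where
  smooth := s.smoothAt_field' hy a
  extends_near := by
    filter_upwards [s.dom.open_source.mem_nhds hy] with z hz
    exact s.push_field hι hz a

/-- The coordinates of a tangent vector of the surface at `p`. -/
def coord (u : TangentSpace (𝓡 (n - 1)) p) : EuclideanSpace ℝ (Fin (n - 1)) :=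
  mfderiv (𝓡 (n - 1)) 𝓘(ℝ, EuclideanSpace ℝ (Fin (n - 1))) s.dom p u

theorem coordField_mfderiv {y : N} (hy : y ∈ s.dom.source) (u : TangentSpace (𝓡 (n - 1)) y) :
    s.field (mfderiv (𝓡 (n - 1)) 𝓘(ℝ, EuclideanSpace ℝ (Fin (n - 1))) s.dom y u) y = u := by
  have h := mfderiv_isInvertible s.dom_mem hy
  have h3 := mfderiv_coordField s.dom_mem hy
    (mfderiv (𝓡 (n - 1)) 𝓘(ℝ, EuclideanSpace ℝ (Fin (n - 1))) s.dom y u)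
  obtain ⟨e, he⟩ := h
  rw [← he] at h3
  have := e.injective h3
  rw [he] at this
  exact this

theorem field_coord (u : TangentSpace (𝓡 (n - 1)) p) : s.field (s.coord u) p = u :=
  s.coordField_mfderiv s.mem_dom u

/-- A smooth retraction onto the surface near `p`. -/
def retraction : M → N := fun z => s.dom.symm (s.π (s.cod z))

theorem retraction_apply {y : N} (hy : y ∈ s.dom.source) : s.retraction (ι y) = y := by
  rw [retraction, s.apply y hy, s.left_inv, s.dom.left_inv hy]

theorem contMDiffAt_retraction : ContMDiffAt (𝓡 n) (𝓡 (n - 1)) ∞ s.retraction (ι p) := by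
  have h1 : ContMDiffAt (𝓡 n) 𝓘(ℝ, EuclideanSpace ℝ (Fin n)) ∞ s.cod (ι p) :=
    contMDiffAt_of_mem_maximalAtlas s.cod_mem (s.mem_cod p s.mem_dom)
  have h2 : ContMDiffAt (𝓡 n) 𝓘(ℝ, EuclideanSpace ℝ (Fin (n - 1))) ∞ (fun z => s.π (s.cod z))
      (ι p) :=
    s.π.contMDiff.contMDiffAt.comp (ι p) h1
  have e : s.π (s.cod (ι p)) = s.dom p := by rw [s.apply p s.mem_dom, s.left_inv]
  have h3 : ContMDiffAt 𝓘(ℝ, EuclideanSpace ℝ (Fin (n - 1))) (𝓡 (n - 1)) ∞ s.dom.symm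
      (s.π (s.cod (ι p))) := by
    rw [e]
    exact contMDiffAt_symm_of_mem_maximalAtlas s.dom_mem (s.dom.map_source s.mem_dom)
  exact h3.comp (ι p) h2

/-- The coefficients of Y in the coordinate frame are pulled back along the retraction and attached
to the extended frame. -/
theorem exists_extension (s : SliceCharts n ι p) (hι : ContMDiff (𝓡 (n - 1)) (𝓡 n) ∞ ι) {Y : VField
    (n - 1) N}
    (hY : SmoothAt (n := n - 1) Y p) : ∃ Y' : VField n M, IsExtensionAt (n := n) ι p Y Y' := by
  let b := EuclideanSpace.basisFun (Fin (n - 1)) ℝ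
  let x : Fin (n - 1) → N → ℝ := fun i y => s.dom y i
  have hx (i) {y : N} (hy : y ∈ s.dom.source) : FunSmoothAt (n := n - 1) (x i) y :=
    (EuclideanSpace.proj (𝕜 := ℝ) i).contMDiff.contMDiffAt.comp y
      (contMDiffAt_of_mem_maximalAtlas s.dom_mem hy)
  let c : Fin (n - 1) → N → ℝ := fun i => dirDeriv Y (x i)
  have hc (i) : FunSmoothAt (n := n - 1) (c i) p := (hx i s.mem_dom).dirDeriv hY
  have hc' (i) : FunSmoothAt (n := n) (c i ∘ s.retraction) (ι p) := by
    have h := s.contMDiffAt_retraction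
    refine ContMDiffAt.comp (ι p) (I' := 𝓡 (n - 1)) ?_ h
    rw [s.retraction_apply s.mem_dom]
    exact hc i
  refine ⟨fun z => ∑ i, ((c i ∘ s.retraction) • s.field' (b i)) z, ?_, ?_⟩
  · exact SmoothAt.sum fun i => SmoothAt.smul (hc' i) (s.smoothAt_field' s.mem_dom _)
  · filter_upwards [s.eventually_mem] with y hy
    have hd : MDifferentiableAt (𝓡 (n - 1)) 𝓘(ℝ, EuclideanSpace ℝ (Fin (n - 1))) s.dom y :=
      (contMDiffAt_of_mem_maximalAtlas s.dom_mem hy).mdifferentiableAt (by simp)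
    have ec (i) : c i y
        = (EuclideanSpace.proj i : EuclideanSpace ℝ (Fin (n - 1)) →L[ℝ] ℝ)
            (mfderiv (𝓡 (n - 1)) 𝓘(ℝ, EuclideanSpace ℝ (Fin (n - 1))) s.dom y (Y y)) := by
      have := mfderiv_comp_apply (I := 𝓡 (n - 1)) (I' := 𝓘(ℝ, EuclideanSpace ℝ (Fin (n - 1))))
        (I'' := 𝓘(ℝ, ℝ)) y ((EuclideanSpace.proj (𝕜 := ℝ) i).mdifferentiableAt) hd (Y y)
      rw [ContinuousLinearMap.mfderiv_eq] at this
      exact this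
    obtain ⟨e, he⟩ := mfderiv_isInvertible s.dom_mem hy
    have hY2 : Y y = ∑ i, c i y • s.field (b i) y := by
      apply e.injective
      rw [map_sum]
      have hb (i) : e (c i y • s.field (b i) y) = c i y • b i := by
        rw [map_smul]
        have h3 := mfderiv_coordField s.dom_mem hy (b i)
        rw [← he] at h3
        exact congrArg (c i y • ·) h3
      have h4 := b.sum_repr (e (Y y))
      refine h4.symm.trans (Finset.sum_congr rfl fun i _ => ?_)
      refine Eq.trans ?_ (hb i).symm
      rw [ec, ← he]
      simp only [b]
      exact congrArg (· • (EuclideanSpace.basisFun (Fin (n - 1)) ℝ i))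
          (EuclideanSpace.basisFun_repr _ _ _ _).symm
    conv_rhs => rw [hY2, map_sum]
    refine Finset.sum_congr rfl fun i _ => ?_
    rw [map_smul, ← s.push_field hι hy]
    have h5 : ((c i ∘ s.retraction) • s.field' (b i)) (ι y)
        = c i (s.retraction (ι y)) • s.field' (b i) (ι y) := rfl
    rw [h5, s.retraction_apply hy]

end SliceCharts
end Adapted

/-! ### The induced connection, its curvature, and the ambient Ricci tensor. -/

section Induced
variable {n : ℕ} {M : Type*} [TopologicalSpace M] [ChartedSpace (EuclideanSpace ℝ (Fin n)) M]
  [IsManifold (𝓡 n) ∞ M]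
  {N : Type*} [TopologicalSpace N] [ChartedSpace (EuclideanSpace ℝ (Fin (n - 1))) N]
  [IsManifold (𝓡 (n - 1)) ∞ N] {ι : N → M} {g : LorentzMetric n M} {nabla : Connection n M}
  {D : Connection (n - 1) N}

instance (x : M) : FiniteDimensional ℝ (TangentSpace (𝓡 n) x) :=
  inferInstanceAs (FiniteDimensional ℝ (EuclideanSpace ℝ (Fin n)))

theorem push_injective (hι : Manifold.IsSmoothEmbedding (𝓡 (n - 1)) (𝓡 n) ∞ ι) (p : N) :
    Function.Injective (push (n := n) ι p) :=
  (exists_sliceCharts hι p).some.push_injective hι.contMDiff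

theorem IsInducedConnection.torsion_eq_zero (h : IsInducedConnection nabla ι D)
    (hι : Manifold.IsSmoothEmbedding (𝓡 (n - 1)) (𝓡 n) ∞ ι) (hLC : IsLeviCivita g nabla) :
    D.torsion = 0 := by
  ext p u v : 3
  obtain ⟨s⟩ := exists_sliceCharts hι p
  have hs (a) := s.smoothAt_field s.mem_dom a
  have h1 := D.torsion_apply (hs (s.coord u)).diffAt (hs (s.coord v)).diffAt
  have e (a b) := h.eq p (s.field a) (s.field' a) (hs a) (s.isExtensionAt_field hι.contMDiff
      s.mem_dom a)
    (s.field b p)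
  have b0 : VectorField.mlieBracket (𝓡 (n - 1)) (s.field (s.coord u)) (s.field (s.coord v)) p = 0 :=
    lieBracket_coordField s.dom_mem s.mem_dom _ _
  have b1 : VectorField.mlieBracket (𝓡 n) (s.field' (s.coord u)) (s.field' (s.coord v)) (ι p) = 0 :=
    lieBracket_coordField s.cod_mem (s.mem_cod p s.mem_dom) _ _
  have h2 := hLC.bracket (s.smoothAt_field' s.mem_dom (s.coord u)).diffAt
    (s.smoothAt_field' s.mem_dom (s.coord v)).diffAt
  rw [b1, add_zero, s.push_field hι.contMDiff s.mem_dom, s.push_field hι.contMDiff s.mem_dom,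
    ← e, ← e] at h2
  have h3 := push_injective hι p h2
  rw [b0, h3, sub_self, sub_zero, s.field_coord, s.field_coord] at h1
  exact h1

theorem IsInducedConnection.bracket (h : IsInducedConnection nabla ι D)
    (hι : Manifold.IsSmoothEmbedding (𝓡 (n - 1)) (𝓡 n) ∞ ι) (hLC : IsLeviCivita g nabla)
    {X Y : VField (n - 1) N} {p : N} (hX : DiffAt X p) (hY : DiffAt Y p) :
    VectorField.mlieBracket (𝓡 (n - 1)) X Y p = D Y p (X p) - D X p (Y p) :=
  ((D.torsion_eq_zero_iff).1 (h.torsion_eq_zero hι hLC) hX hY).symm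

theorem IsInducedConnection.metric (h : IsInducedConnection nabla ι D)
    (hι : Manifold.IsSmoothEmbedding (𝓡 (n - 1)) (𝓡 n) ∞ ι) (hLC : IsLeviCivita g nabla)
    {Y Z : VField (n - 1) N} {p : N} (hY : SmoothAt Y p) (hZ : SmoothAt Z p)
    (u : TangentSpace (𝓡 (n - 1)) p) :
    mvfderiv (𝓡 (n - 1)) (fun y => inducedMetric ι g y (Y y) (Z y)) p u
      = inducedMetric ι g p (D Y p u) (Z p) + inducedMetric ι g p (Y p) (D Z p u) := by
  obtain ⟨s⟩ := exists_sliceCharts hι p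
  obtain ⟨Y', hY'⟩ := s.exists_extension hι.contMDiff hY
  obtain ⟨Z', hZ'⟩ := s.exists_extension hι.contMDiff hZ
  have e : (fun y => inducedMetric ι g y (Y y) (Z y))
      =ᶠ[𝓝 p] (fun z => g.val z (Y' z) (Z' z)) ∘ ι := by
    filter_upwards [hY'.extends_near, hZ'.extends_near] with y h1 h2
    simp only [inducedMetric, Function.comp, h1, h2]
  have e2 : mvfderiv (𝓡 (n - 1)) (fun y => inducedMetric ι g y (Y y) (Z y)) p
      = mvfderiv (𝓡 (n - 1)) ((fun z => g.val z (Y' z) (Z' z)) ∘ ι) p := by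
    simp only [mvfderiv, e.mfderiv_eq]
    rfl
  have h3 := mvfderiv_comp_apply (I := 𝓡 n) p
    (g.smooth_apply hY'.smooth hZ'.smooth).diffAt
    ((hι.contMDiff p).mdifferentiableAt (by simp)) u
  rw [e2, h3, hLC.metric _ Y' Z' hY'.smooth.diffAt hZ'.smooth.diffAt, hY'.extends_near.self_of_nhds,
    hZ'.extends_near.self_of_nhds]
  simp only [inducedMetric, h.eq p Y Y' hY hY', h.eq p Z Z' hZ hZ']

/-- The curvature of the space-time on tangent vectors is the curvature of the induced connection.
-/
theorem IsInducedConnection.push_curvatureAt (h : IsInducedConnection nabla ι D)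
    (hι : Manifold.IsSmoothEmbedding (𝓡 (n - 1)) (𝓡 n) ∞ ι) (hLC : IsLeviCivita g nabla)
    (p : N) (u v w : TangentSpace (𝓡 (n - 1)) p) :
    push ι p (curvatureAt D p u v w)
      = curvatureAt nabla (ι p) (push ι p u) (push ι p v) (push ι p w) := by
  obtain ⟨s⟩ := exists_sliceCharts hι p
  have hs (a) := s.smoothAt_field s.mem_dom a
  have hs' (a) := s.smoothAt_field' s.mem_dom a
  -- The coordinate fields extend each other at every point of the chart, so ∇_X' Y' extends D_X Y
  -- near p and the defining equation of D can be applied a second time.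
  have ext2 (a b) : IsExtensionAt ι p (D.along (s.field a) (s.field b))
      (nabla.along (s.field' a) (s.field' b)) := by
    refine ⟨hLC.smooth _ _ _ (hs' a) (hs' b), ?_⟩
    filter_upwards [s.eventually_mem] with y hy
    simp only [Connection.along]
    rw [h.eq y _ _ (s.smoothAt_field hy b) (s.isExtensionAt_field hι.contMDiff hy b),
      s.push_field hι.contMDiff hy]
  have e (a b c) := h.eq p _ _ (h.smooth _ _ _ (hs a) (hs b)) (ext2 a b) (s.field c p)
  have c1 := curvature_eq_curvatureAt h.smooth (hs (s.coord u)) (hs (s.coord v)) (hs (s.coord w))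
  have c2 := curvature_eq_curvatureAt hLC.smooth (hs' (s.coord u)) (hs' (s.coord v)) (hs'
      (s.coord w))
  simp only [s.push_field hι.contMDiff s.mem_dom, s.field_coord] at c1 c2
  rw [← c1, ← c2]
  have b0 : VectorField.mlieBracket (𝓡 (n - 1)) (s.field (s.coord u)) (s.field (s.coord v)) p = 0 :=
    lieBracket_coordField s.dom_mem s.mem_dom _ _
  have b1 : VectorField.mlieBracket (𝓡 n) (s.field' (s.coord u)) (s.field' (s.coord v)) (ι p) = 0 :=
    lieBracket_coordField s.cod_mem (s.mem_cod p s.mem_dom) _ _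
  simp only [curvature, b0, b1, map_sub, map_zero, e, s.push_field hι.contMDiff s.mem_dom]

/-- Degeneracy puts the tangent space of the surface inside the orthogonal complement of l; both
have dimension n - 1. The vector k is a transversal normalised against l, which exists by
nondegeneracy of g. -/
theorem InNullDirection.ker_eq_range (hι : Manifold.IsSmoothEmbedding (𝓡 (n - 1)) (𝓡 n) ∞ ι)
    {p : N} {l : TangentSpace (𝓡 (n - 1)) p} (hl : InNullDirection g ι p l) (hl0 : l ≠ 0) :
    (∃ k, g.val (ι p) (push ι p l) k = 1) ∧
    LinearMap.ker (g.val (ι p) (push ι p l)).toLinearMap = LinearMap.range (push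
        (n := n) ι p).toLinearMap := by
  have hinj := push_injective hι p
  have h0 : push (n := n) ι p l ≠ 0 := fun h => hl0 (hinj (h.trans (map_zero _).symm))
  have hk : ∃ k, g.val (ι p) (push ι p l) k = 1 := by
    by_contra hcon
    push Not at hcon
    apply h0
    apply g.eq_zero_of_orthogonal
    intro w
    by_contra hw
    rw [g.symm] at hw
    apply hcon ((g.val (ι p) (push ι p l) w)⁻¹ • w)
    rw [map_smul, smul_eq_mul, inv_mul_cancel₀ hw]
  refine ⟨hk, ?_⟩
  obtain ⟨k, hk⟩ := hk
  symm
  apply Submodule.eq_of_le_of_finrank_eq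
  · rintro _ ⟨w, rfl⟩
    exact hl w
  · have h1 := LinearMap.finrank_range_add_finrank_ker (g.val (ι p) (push ι p l)).toLinearMap
    have h2 : Module.finrank ℝ (LinearMap.range (push (n := n) ι p).toLinearMap) = n - 1 := by
      rw [LinearMap.finrank_range_of_inj hinj]
      exact finrank_euclideanSpace_fin
    have h3 : Module.finrank ℝ (TangentSpace (𝓡 n) (ι p)) = n := finrank_euclideanSpace_fin
    have h4 : LinearMap.range (g.val (ι p) (push ι p l)).toLinearMap = ⊤ := by
      rw [LinearMap.range_eq_top]
      intro r
      exact ⟨r • k, by simp [hk]⟩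
    rw [h4, h3, finrank_top, Module.finrank_self] at h1
    rw [h2]
    omega

/-- The Ricci tensor of the space-time on tangent vectors, in terms of the induced connection. -/
theorem IsInducedConnection.ricci_push (h : IsInducedConnection nabla ι D)
    (hι : Manifold.IsSmoothEmbedding (𝓡 (n - 1)) (𝓡 n) ∞ ι) (hLC : IsLeviCivita g nabla)
    {p : N} {l : TangentSpace (𝓡 (n - 1)) p} (hl : InNullDirection g ι p l) (hl0 : l ≠ 0)
    (v w : TangentSpace (𝓡 (n - 1)) p) {c : ℝ} (hc : curvatureAt D p l w v = c • l) :
    ricci nabla (ι p) (push ι p v) (push ι p w)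
      = LinearMap.trace ℝ (TangentSpace (𝓡 (n - 1)) p) (curvatureMap h.smooth p v w) + c := by
  obtain ⟨⟨k, hk⟩, hker⟩ := hl.ker_eq_range hι hl0
  rw [ricci_eq_trace hLC.smooth]
  have ht := trace_eq_trace_add_of_intertwines (V := TangentSpace (𝓡 n) (ι p))
    (W := TangentSpace (𝓡 (n - 1)) p)
    (push (n := n) ι p).toLinearMap (push_injective hι p)
    (g.val (ι p) (push ι p l)).toLinearMap hker (k := k) hk
    (curvatureMap hLC.smooth (ι p) (push ι p v) (push ι p w)) (curvatureMap h.smooth p v w)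
    (fun u => (h.push_curvatureAt hι hLC p u v w).symm)
  rw [ht]
  congr 1
  change g.val (ι p) (push ι p l) (curvatureAt nabla (ι p) k (push ι p v) (push ι p w)) = c
  -- Writing l, v, w for their pushforwards: g(R(k,v)w, l) = g(R(w,l)k, v) = -g(R(w,l)v, k) =
  -- g(R(l,w)v, k). Only tangent vectors remain inside R, so the curvature of D suffices.
  rw [g.symm, hLC.metric_curvature_pair, hLC.metric_curvature_swap, curvatureAt_swap,
    ← h.push_curvatureAt hι hLC, hc]
  simp [hk]

end Induced

/-! ### Consequences of the symmetry: curvature along ℓ and the zeroth law. -/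

section Isolated
variable {n : ℕ} {M : Type*} [TopologicalSpace M] [ChartedSpace (EuclideanSpace ℝ (Fin n)) M]
  [IsManifold (𝓡 n) ∞ M]

/-- If a smooth field is a multiple of a nonvanishing smooth field, then the factor is smooth. -/
theorem smooth_factor {l : VField n M} {f : M → ℝ} {x : M} (hl : SmoothAt l x) (h0 : l x ≠ 0)
    (hfl : SmoothAt (f • l) x) : FunSmoothAt (n := n) f x := by
  let t := trivializationAt (EuclideanSpace ℝ (Fin n)) (TangentSpace (𝓡 n) : M → Type _) x
  have x_mem : x ∈ t.baseSet := FiberBundle.mem_baseSet_trivializationAt _ _ x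
  let b := Module.Basis.ofVectorSpace ℝ (EuclideanSpace ℝ (Fin n))
  let c := t.localFrameCoeff (𝓡 n) b
  have hc {Z : VField n M} (hZ : SmoothAt Z x) (i) :
      FunSmoothAt (n := n) (fun y => c i y (Z y)) x :=
    contMDiffAt_localFrameCoeff b x_mem hZ i
  obtain ⟨i, hi⟩ : ∃ i, c i x (l x) ≠ 0 := by
    by_contra hcon
    push Not at hcon
    apply h0
    have h1 := (t.eventually_eq_localFrame_sum_coeff_smul (I := 𝓡 n) (s := l) b x_mem).self_of_nhds
    rw [h1]
    exact Finset.sum_eq_zero fun i _ => by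
      have := hcon i
      simp only [c] at this
      rw [this, zero_smul]
  have h2 : FunSmoothAt (n := n) (fun y => c i y ((f • l) y) / c i y (l y)) x :=
    ContMDiffAt.div₀ (hc hfl i) (hc hl i) hi
  refine h2.congr_of_eventuallyEq ?_
  have h3 : ∀ᶠ y in 𝓝 x, c i y (l y) ≠ 0 := (hc hl i).continuousAt.eventually_ne hi
  filter_upwards [h3] with y hy
  have : c i y ((f • l) y) = f y * c i y (l y) := by
    rw [Pi.smul_apply', map_smul, smul_eq_mul]
  rw [this, mul_div_cancel_right₀ _ hy]

variable {N : Type*} [TopologicalSpace N] [ChartedSpace (EuclideanSpace ℝ (Fin (n - 1))) N]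
  [IsManifold (𝓡 (n - 1)) ∞ N] {ι : N → M} {g : LorentzMetric n M} {nabla : Connection n M}
  {D : Connection (n - 1) N} {ℓ : VField (n - 1) N}
  {rot : Π p : N, TangentSpace (𝓡 (n - 1)) p →L[ℝ] ℝ}

/-- With k transversal and g(l,k) = 1, the vectors v and g(v,k) l have the same products with the
surface and with k, hence coincide. -/
theorem InNullDirection.exists_smul (hι : Manifold.IsSmoothEmbedding (𝓡 (n - 1)) (𝓡 n) ∞ ι)
    {p : N} {l v : TangentSpace (𝓡 (n - 1)) p} (hl : InNullDirection g ι p l) (hl0 : l ≠ 0)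
    (hv : InNullDirection g ι p v) : ∃ c : ℝ, v = c • l := by
  obtain ⟨⟨k, hk⟩, hker⟩ := hl.ker_eq_range hι hl0
  refine ⟨g.val (ι p) (push ι p v) k, ?_⟩
  apply push_injective hι p
  rw [map_smul, ← sub_eq_zero]
  apply g.eq_zero_of_orthogonal
  intro w
  have hw : w - g.val (ι p) (push ι p l) w • k ∈ LinearMap.range (push
      (n := n) ι p).toLinearMap := by
    rw [← hker]; simp [hk]
  obtain ⟨z, hz⟩ := hw
  have hw : w = push ι p z + g.val (ι p) (push ι p l) w • k := by
    rw [← sub_eq_iff_eq_add]; exact hz.symm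
  have h1 : g.val (ι p) (push ι p v) (push ι p z) = 0 := hv z
  have h2 : g.val (ι p) (push ι p v) w
      = g.val (ι p) (push ι p l) w * g.val (ι p) (push ι p v) k := by
    conv_lhs => rw [hw]
    rw [map_add, h1, map_smul, zero_add, smul_eq_mul]
  rw [g.symm, map_sub, map_smul, sub_apply, smul_apply, h2, smul_eq_mul]
  ring

/-- The potential carries no regularity assumption; smoothness is inherited from D_Y ℓ, of which it
is the factor along ℓ. -/
theorem IsRotationPotential.smooth_apply (hrot : IsRotationPotential D ℓ rot) (hD : D.IsSmooth)
    {p : N} (hℓ : SmoothAt ℓ p) (h0 : ℓ p ≠ 0) {Y : VField (n - 1) N} (hY : SmoothAt Y p) :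
    FunSmoothAt (n := n - 1) (fun y => rot y (Y y)) p := by
  apply smooth_factor hℓ h0
  have e : (fun y => rot y (Y y)) • ℓ = D.along Y ℓ := by
    ext1 y
    exact (hrot y (Y y)).symm
  rw [e]
  exact hD p Y ℓ hY hℓ

theorem IsRotationPotential.along_eq (hrot : IsRotationPotential D ℓ rot) (Y : VField (n - 1) N) :
    D.along Y ℓ = (fun y => rot y (Y y)) • ℓ := by
  ext1 y
  exact hrot y (Y y)

/-- `D_u (D_Y ℓ)` in terms of the rotation potential. -/
theorem IsRotationPotential.second (hrot : IsRotationPotential D ℓ rot) (hD : D.IsSmooth)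
    {p : N} (hℓ : SmoothAt ℓ p) (h0 : ℓ p ≠ 0) {Y : VField (n - 1) N} (hY : SmoothAt Y p)
    (u : TangentSpace (𝓡 (n - 1)) p) :
    D (D.along Y ℓ) p u
      = (mvfderiv (𝓡 (n - 1)) (fun y => rot y (Y y)) p u + rot p (Y p) * rot p u) • ℓ p := by
  rw [hrot.along_eq, D.smul_apply (hrot.smooth_apply hD hℓ h0 hY).diffAt hℓ.diffAt, hrot p u]
  module

/-- The curvature of the induced connection in the direction of the symmetry. -/
theorem IsIsolatedNullSurface.curvature_flow (hN : IsIsolatedNullSurface g nabla ι D ℓ)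
    (hLC : IsLeviCivita g nabla) (hrot : IsRotationPotential D ℓ rot) {p : N}
    {X Y : VField (n - 1) N} (hX : SmoothAt X p) (hY : SmoothAt Y p) :
    curvatureAt D p (ℓ p) (X p) (Y p)
      = (rot p (D Y p (X p)) - mvfderiv (𝓡 (n - 1)) (fun y => rot y (Y y)) p (X p)
          - rot p (Y p) * rot p (X p)) • ℓ p := by
  have hι := hN.null.embedding
  have hD := hN.induced.smooth
  have hℓ := hN.flow_smooth p
  have hXY := hD p X Y hX hY
  have hℓY := hD p ℓ Y hℓ hY
  have hYℓ := hD p Y ℓ hY hℓ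
  have h1 := hN.lie_connection p X Y hX hY
  have e : ∀ᶠ y in 𝓝 p, VectorField.mlieBracket (𝓡 (n - 1)) ℓ Y y
      = (D.along ℓ Y - D.along Y ℓ) y := by
    filter_upwards [hY.eventually_diffAt] with y hy
    exact hN.induced.bracket hι hLC (hN.flow_smooth y).diffAt hy
  have e1 : D (VectorField.mlieBracket (𝓡 (n - 1)) ℓ Y) p (X p)
      = D (D.along ℓ Y) p (X p) - D (D.along Y ℓ) p (X p) := by
    rw [D.congr_of_eventually (smooth_lieBracket hℓ hY).diffAt (hℓY.sub hYℓ).diffAt e,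
      eq_sub_iff_add_eq, ← D.add_apply (hℓY.sub hYℓ).diffAt hYℓ.diffAt, sub_add_cancel]
  -- With brackets replaced through vanishing torsion, the commutator [L_ℓ, D] becomes R(ℓ,X)Y + D_X
  -- D_Y ℓ - D_{D_X Y} ℓ, and the last two terms are known from the rotation potential.
  rw [lieConnection, hN.induced.bracket hι hLC hℓ.diffAt hXY.diffAt, e1,
    hrot.second hD hℓ (hN.flow_ne_zero p) hY, hrot] at h1
  rw [← curvature_eq_curvatureAt hD hℓ hX hY, curvature]
  simp only [Connection.along] at h1 ⊢
  rw [← sub_eq_zero, ← h1]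
  module

/-- The curvature of the induced connection maps the null field to its multiples. -/
theorem IsRotationPotential.curvature_apply (hrot : IsRotationPotential D ℓ rot) (hD : D.IsSmooth)
    {p : N} (hℓ : SmoothAt ℓ p) (h0 : ℓ p ≠ 0) (u v : TangentSpace (𝓡 (n - 1)) p) :
    ∃ c : ℝ, curvatureAt D p u v (ℓ p) = c • ℓ p := by
  have hX := smoothAt_extend p u
  have hY := smoothAt_extend p v
  have h1 := curvature_eq_curvatureAt hD hX hY hℓ
  simp only [FiberBundle.extend_apply_self] at h1
  rw [← h1, curvature, hrot.second hD hℓ h0 hX, hrot.second hD hℓ h0 hY, hrot, ← sub_smul, ←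
      sub_smul]
  exact ⟨_, rfl⟩

theorem IsIsolatedNullSurface.smoothAt_surfaceGravity (hN : IsIsolatedNullSurface g nabla ι D ℓ)
    (hrot : IsRotationPotential D ℓ rot) (p : N) :
    FunSmoothAt (n := n - 1) (fun y => rot y (ℓ y)) p :=
  hrot.smooth_apply hN.induced.smooth (hN.flow_smooth p) (hN.flow_ne_zero p) (hN.flow_smooth p)

/-- The zeroth law: the surface gravity is constant. -/
theorem IsIsolatedNullSurface.surfaceGravity_const (hN : IsIsolatedNullSurface g nabla ι D ℓ)
    (hLC : IsLeviCivita g nabla) (hrot : IsRotationPotential D ℓ rot) (hn : 2 < n) {Λ : ℝ}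
    (hE : VacuumEinsteinOn g nabla Λ (Set.range ι)) (p : N) (v : TangentSpace (𝓡 (n - 1)) p) :
    mvfderiv (𝓡 (n - 1)) (fun y => rot y (ℓ y)) p v = 0 := by
  have hD := hN.induced.smooth
  have hℓ := hN.flow_smooth p
  have h0 := hN.flow_ne_zero p
  -- This removes the transversal term from Ric(v,ℓ).
  have hself : curvatureAt D p (ℓ p) (ℓ p) v = (0 : ℝ) • ℓ p := by
    rw [zero_smul]
    have h := curvatureAt_swap (D := D) p (ℓ p) (ℓ p) v
    have h2 : (2 : ℝ) • curvatureAt D p (ℓ p) (ℓ p) v = 0 := by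
      rw [two_smul]
      nth_rewrite 1 [h]
      exact neg_add_cancel _
    exact (smul_eq_zero.1 h2).resolve_left two_ne_zero
  have h1 := hN.induced.ricci_push hN.null.embedding hLC (hN.flow_null p) h0 v (ℓ p) hself
  have h2 : g.val (ι p) (push ι p v) (push ι p (ℓ p)) = 0 := by
    rw [g.symm]; exact hN.flow_null p v
  have h3 := hN.curvature_flow hLC hrot (smoothAt_extend p v) hℓ
  simp only [FiberBundle.extend_apply_self] at h3
  -- The trace is the coefficient of R(ℓ,v)ℓ; as ω(D_v ℓ) = ω(v) κ cancels the quadratic term, it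
  -- equals -dκ(v), while Ric(v,ℓ) is a multiple of g(v,ℓ) = 0.
  have h4 := trace_smul_vector (curvatureMap hD p v (ℓ p)) h0
    (fun u => hrot.curvature_apply hD hℓ h0 u v) h3
  rw [ricci_eq_of_vacuum hn hE ⟨p, rfl⟩, h2, h4, hrot p v, map_smul, smul_eq_mul] at h1
  linarith

end Isolated

/-! ### Comparison of the two null fields and the two connections. -/

section Comparison
variable {n : ℕ} {M₁ : Type*} [TopologicalSpace M₁] [ChartedSpace (EuclideanSpace ℝ (Fin n)) M₁]
  [IsManifold (𝓡 n) ∞ M₁]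
  {M₂ : Type*} [TopologicalSpace M₂] [ChartedSpace (EuclideanSpace ℝ (Fin n)) M₂]
  [IsManifold (𝓡 n) ∞ M₂]
  {N : Type*} [TopologicalSpace N] [ChartedSpace (EuclideanSpace ℝ (Fin (n - 1))) N]
  [IsManifold (𝓡 (n - 1)) ∞ N]
  {g₁ : LorentzMetric n M₁} {nabla₁ : Connection n M₁}
  {g₂ : LorentzMetric n M₂} {nabla₂ : Connection n M₂}
  {ι₁ : N → M₁} {D₁ : Connection (n - 1) N} {ℓ₁ : VField (n - 1) N}
  {ι₂ : N → M₂} {D₂ : Connection (n - 1) N} {ℓ₂ : VField (n - 1) N}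
  {rot : Π p : N, TangentSpace (𝓡 (n - 1)) p →L[ℝ] ℝ}

/-- Two null normals with the same rotation potential on non-extremal surfaces with the same metric
are, to first order, constant multiples of each other. -/
theorem rotation_of_other_normal (hn : 2 < n) (hLC₁ : IsLeviCivita g₁ nabla₁)
    (hLC₂ : IsLeviCivita g₂ nabla₂)
    (hN₁ : IsIsolatedNullSurface g₁ nabla₁ ι₁ D₁ ℓ₁) (hκ₁ : IsNonExtremal D₁ ℓ₁)
    (hN₂ : IsIsolatedNullSurface g₂ nabla₂ ι₂ D₂ ℓ₂) {Λ : ℝ}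
    (hE₁ : VacuumEinsteinOn g₁ nabla₁ Λ (Set.range ι₁))
    (hE₂ : VacuumEinsteinOn g₂ nabla₂ Λ (Set.range ι₂))
    (hq : ∀ (p : N) (u v : TangentSpace (𝓡 (n - 1)) p),
      inducedMetric ι₁ g₁ p u v = inducedMetric ι₂ g₂ p u v)
    (hrot₁ : IsRotationPotential D₁ ℓ₁ rot) (hrot₂ : IsRotationPotential D₂ ℓ₂ rot) :
    IsRotationPotential D₂ ℓ₁ rot ∧ ∀ p, rot p (ℓ₁ p) ≠ 0 ∧ ∃ c : ℝ, c ≠ 0 ∧ ℓ₂ p = c • ℓ₁ p := by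
  have hnull (p : N) : InNullDirection g₁ ι₁ p (ℓ₂ p) := fun w =>
    (hq p _ w).trans (hN₂.flow_null p w)
  choose f hf using fun p => (hN₁.flow_null p).exists_smul hN₁.null.embedding (hN₁.flow_ne_zero p)
      (hnull p)
  have hf' : ℓ₂ = f • ℓ₁ := by ext1 p; exact hf p
  have hf0 (p : N) : f p ≠ 0 := by
    intro h
    apply hN₂.flow_ne_zero p
    rw [hf, h, zero_smul]
  have hfs (p : N) : FunSmoothAt (n := n - 1) f p :=
    smooth_factor (hN₁.flow_smooth p) (hN₁.flow_ne_zero p) (hf' ▸ hN₂.flow_smooth p)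
  have hκ (p : N) : rot p (ℓ₁ p) ≠ 0 := by
    obtain ⟨κ, h0, h1⟩ := hκ₁ p
    rw [hrot₁] at h1
    have := smul_left_injective ℝ (hN₁.flow_ne_zero p) h1
    rwa [this]
  have hdf (p : N) (v : TangentSpace (𝓡 (n - 1)) p) : mvfderiv (𝓡 (n - 1)) f p v = 0 := by
    -- A common potential gives κ₂ = f κ₁. Both surface gravities have zero differential, hence κ₁
    -- df = 0.
    have e : (fun y => rot y (ℓ₂ y)) = f * (fun y => rot y (ℓ₁ y)) := by
      ext y
      rw [hf y, map_smul]
      rfl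
    have h1 := hN₂.surfaceGravity_const hLC₂ hrot₂ hn hE₂ p v
    rw [e, mvfderiv_mul (hfs p).diffAt (hN₁.smoothAt_surfaceGravity hrot₁ p).diffAt] at h1
    have h2 := hN₁.surfaceGravity_const hLC₁ hrot₁ hn hE₁ p v
    have h3 : rot p (ℓ₁ p) * mvfderiv (𝓡 (n - 1)) f p v = 0 := by
      simpa [h2] using h1
    exact (mul_eq_zero.1 h3).resolve_left (hκ p)
  refine ⟨fun p v => ?_, fun p => ⟨hκ p, f p, hf0 p, hf p⟩⟩
  have h1 := hrot₂ p v
  rw [hf', D₂.smul_apply (hfs p).diffAt (hN₁.flow_smooth p).diffAt, hdf, zero_smul, add_zero,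
    Pi.smul_apply', smul_comm] at h1
  exact smul_right_injective _ (hf0 p) h1

/-- Two torsion-free connections annihilating the same degenerate metric differ by a symmetric
tensor with values in the null direction. -/
theorem difference_symm {D₁ D₂ : Connection (n - 1) N} (h₁ : D₁.torsion = 0) (h₂ : D₂.torsion = 0)
    (p : N) (u v : TangentSpace (𝓡 (n - 1)) p) :
    CovariantDerivative.difference D₁ D₂ p u v = CovariantDerivative.difference D₁ D₂ p v u := by
  have hX := (smoothAt_extend p u).diffAt
  have hY := (smoothAt_extend p v).diffAt
  have e₁ := (D₁.torsion_eq_zero_iff).1 h₁ hX hY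
  have e₂ := (D₂.torsion_eq_zero_iff).1 h₂ hX hY
  have d₁ := congrArg (fun T => T v) (IsCovariantDerivativeOn.difference_apply
    D₁.isCovariantDerivativeOnUniv D₂.isCovariantDerivativeOnUniv trivial hX)
  have d₂ := congrArg (fun T => T u) (IsCovariantDerivativeOn.difference_apply
    D₁.isCovariantDerivativeOnUniv D₂.isCovariantDerivativeOnUniv trivial hY)
  simp only [FiberBundle.extend_apply_self, sub_apply] at d₁ d₂ e₁ e₂
  refine d₁.trans (Eq.trans ?_ d₂.symm)
  rw [← e₂] at e₁
  rw [sub_eq_sub_iff_add_eq_add] at e₁ ⊢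
  rw [add_comm, ← e₁, add_comm]

theorem difference_eq {D₁ D₂ : Connection (n - 1) N} {Y : VField (n - 1) N} {p : N}
    (hY : DiffAt Y p)
    (v : TangentSpace (𝓡 (n - 1)) p) :
    D₁ Y p v = D₂ Y p v + CovariantDerivative.difference D₁ D₂ p (Y p) v := by
  have h := congrArg (fun T => T v) (IsCovariantDerivativeOn.difference_apply
    D₁.isCovariantDerivativeOnUniv D₂.isCovariantDerivativeOnUniv trivial hY)
  have h' : CovariantDerivative.difference D₁ D₂ p (Y p) v = D₁ Y p v - D₂ Y p v := h
  rw [h']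
  abel

/-- This is the uniqueness argument for the Levi-Civita connection: q(C(a,c),b) is symmetric in a, c
and antisymmetric in a, b, hence zero. As q is degenerate, this confines C to the null direction
without making it vanish. -/
theorem difference_null (hLC₁ : IsLeviCivita g₁ nabla₁) (hLC₂ : IsLeviCivita g₂ nabla₂)
    (hι₁ : Manifold.IsSmoothEmbedding (𝓡 (n - 1)) (𝓡 n) ∞ ι₁)
    (hι₂ : Manifold.IsSmoothEmbedding (𝓡 (n - 1)) (𝓡 n) ∞ ι₂)
    (hI₁ : IsInducedConnection nabla₁ ι₁ D₁) (hI₂ : IsInducedConnection nabla₂ ι₂ D₂)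
    (hq : ∀ (p : N) (u v : TangentSpace (𝓡 (n - 1)) p),
      inducedMetric ι₁ g₁ p u v = inducedMetric ι₂ g₂ p u v) (p : N)
    (u v : TangentSpace (𝓡 (n - 1)) p) :
    InNullDirection g₁ ι₁ p (CovariantDerivative.difference D₁ D₂ p u v) := by
  set C := CovariantDerivative.difference D₁ D₂ p with hC
  have symm (a b) : C a b = C b a :=
    difference_symm (hI₁.torsion_eq_zero hι₁ hLC₁) (hI₂.torsion_eq_zero hι₂ hLC₂) p a b
  have anti (a b c : TangentSpace (𝓡 (n - 1)) p) :
      inducedMetric ι₁ g₁ p (C a c) b + inducedMetric ι₁ g₁ p (C b c) a = 0 := by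
    have hX := smoothAt_extend p a
    have hY := smoothAt_extend p b
    have m₁ := hI₁.metric hι₁ hLC₁ hX hY c
    have m₂ := hI₂.metric hι₂ hLC₂ hX hY c
    simp only [← hq] at m₂
    rw [m₂] at m₁
    rw [difference_eq (D₁ := D₁) (D₂ := D₂) hX.diffAt, difference_eq (D₁ := D₁)
        (D₂ := D₂) hY.diffAt] at m₁
    simp only [FiberBundle.extend_apply_self, ← hC] at m₁
    simp only [inducedMetric, map_add, add_apply] at m₁ ⊢
    rw [g₁.symm _ _ (push ι₁ p a)]
    linarith
  intro w
  have a1 := anti u w v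
  have a2 := anti w v u
  have a3 := anti v u w
  rw [symm w v] at a1
  rw [symm w u] at a2
  rw [symm v u] at a2
  linarith

end Comparison

/-! ### Vanishing of the difference tensor. -/

section Rigidity
variable {n : ℕ} {M₁ : Type*} [TopologicalSpace M₁] [ChartedSpace (EuclideanSpace ℝ (Fin n)) M₁]
  [IsManifold (𝓡 n) ∞ M₁]
  {M₂ : Type*} [TopologicalSpace M₂] [ChartedSpace (EuclideanSpace ℝ (Fin n)) M₂]
  [IsManifold (𝓡 n) ∞ M₂]
  {N : Type*} [TopologicalSpace N] [ChartedSpace (EuclideanSpace ℝ (Fin (n - 1))) N]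
  [IsManifold (𝓡 (n - 1)) ∞ N]
  {g₁ : LorentzMetric n M₁} {nabla₁ : Connection n M₁}
  {g₂ : LorentzMetric n M₂} {nabla₂ : Connection n M₂}
  {ι₁ : N → M₁} {D₁ : Connection (n - 1) N} {ℓ₁ : VField (n - 1) N}
  {ι₂ : N → M₂} {D₂ : Connection (n - 1) N} {ℓ₂ : VField (n - 1) N}
  {rot : Π p : N, TangentSpace (𝓡 (n - 1)) p →L[ℝ] ℝ}

/-- If two connections differ by a tensor with values in the multiples of `ℓ`, and the second one
maps `ℓ` to its multiples, then their curvatures differ by multiples of `ℓ`. -/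
theorem curvature_difference (hD₁ : D₁.IsSmooth) (hD₂ : D₂.IsSmooth)
    (hℓ : ∀ p, SmoothAt ℓ₁ p) (h0 : ∀ p, ℓ₁ p ≠ 0) (hrot : IsRotationPotential D₂ ℓ₁ rot)
    (hC : ∀ (p : N) (u v : TangentSpace (𝓡 (n - 1)) p),
      ∃ c : ℝ, CovariantDerivative.difference D₁ D₂ p u v = c • ℓ₁ p)
    (p : N) (u v w : TangentSpace (𝓡 (n - 1)) p) :
    ∃ c : ℝ, curvatureAt D₁ p u v w - curvatureAt D₂ p u v w = c • ℓ₁ p := by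
  choose S hS using hC
  have second {X Y : VField (n - 1) N} (hX : SmoothAt X p) (hY : SmoothAt Y p)
      (u : TangentSpace (𝓡 (n - 1)) p) :
      ∃ c : ℝ, D₁ (D₁.along X Y) p u - D₂ (D₂.along X Y) p u = c • ℓ₁ p := by
    have s₁ := hD₁ p X Y hX hY
    have s₂ := hD₂ p X Y hX hY
    -- Here f ℓ is the difference of the two derivatives of Y along X. Differentiating it with D₂
    -- stays within multiples of ℓ by the rotation potential, and passing from D₂ to D₁ outside adds
    -- one more value of C.
    let f : N → ℝ := fun y => S y (Y y) (X y)
    have e : ∀ᶠ y in 𝓝 p, (f • ℓ₁) y = (D₁.along X Y - D₂.along X Y) y := by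
      filter_upwards [hY.eventually_diffAt] with y hy
      have h := difference_eq (D₁ := D₁) (D₂ := D₂) hy (X y)
      rw [hS] at h
      simp only [Connection.along, Pi.sub_apply, Pi.smul_apply', f, h]
      abel
    have sf : SmoothAt (f • ℓ₁) p := (s₁.sub s₂).congr e
    have hf : FunSmoothAt (n := n - 1) f p := smooth_factor (hℓ p) (h0 p) sf
    have h1 : D₂ (D₁.along X Y) p u = D₂ (D₂.along X Y) p u + D₂ (f • ℓ₁) p u := by
      rw [D₂.congr_of_eventually sf.diffAt (s₁.sub s₂).diffAt e,
        ← D₂.add_apply s₂.diffAt (s₁.sub s₂).diffAt, add_sub_cancel]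
    rw [difference_eq (D₁ := D₁) (D₂ := D₂) s₁.diffAt, hS, h1,
      D₂.smul_apply hf.diffAt (hℓ p).diffAt, hrot]
    exact ⟨f p * rot p u + mvfderiv (𝓡 (n - 1)) f p u + S p (D₁.along X Y p) u, by module⟩
  have hX := smoothAt_extend p u
  have hY := smoothAt_extend p v
  have hZ := smoothAt_extend p w
  obtain ⟨a, ha⟩ := second hY hZ u
  obtain ⟨b, hb⟩ := second hX hZ v
  simp only [curvatureAt, curvature, FiberBundle.extend_apply_self]
  rw [difference_eq (D₁ := D₁) (D₂ := D₂) hZ.diffAt, hS, sub_eq_iff_eq_add.1 ha,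
    sub_eq_iff_eq_add.1 hb]
  exact ⟨a - b - S p _ _, by module⟩

/-- The difference of the connections vanishes, by the difference of the Einstein equations. -/
theorem difference_eq_zero (hn : 2 < n) (hLC₁ : IsLeviCivita g₁ nabla₁)
    (hLC₂ : IsLeviCivita g₂ nabla₂)
    (hN₁ : IsIsolatedNullSurface g₁ nabla₁ ι₁ D₁ ℓ₁) (hκ₁ : IsNonExtremal D₁ ℓ₁)
    (hN₂ : IsIsolatedNullSurface g₂ nabla₂ ι₂ D₂ ℓ₂) {Λ : ℝ}
    (hE₁ : VacuumEinsteinOn g₁ nabla₁ Λ (Set.range ι₁))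
    (hE₂ : VacuumEinsteinOn g₂ nabla₂ Λ (Set.range ι₂))
    (hq : ∀ (p : N) (u v : TangentSpace (𝓡 (n - 1)) p),
      inducedMetric ι₁ g₁ p u v = inducedMetric ι₂ g₂ p u v)
    (hrot₁ : IsRotationPotential D₁ ℓ₁ rot) (hrot₂ : IsRotationPotential D₂ ℓ₂ rot)
    (p : N) (u v : TangentSpace (𝓡 (n - 1)) p) :
    CovariantDerivative.difference D₁ D₂ p u v = 0 := by
  have hι₁ := hN₁.null.embedding
  have hι₂ := hN₂.null.embedding
  have hD₁ := hN₁.induced.smooth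
  have hD₂ := hN₂.induced.smooth
  obtain ⟨hrot, hℓ⟩ := rotation_of_other_normal hn hLC₁ hLC₂ hN₁ hκ₁ hN₂ hE₁ hE₂ hq hrot₁ hrot₂
  obtain ⟨hκ, r, hr0, hr⟩ := hℓ p
  have h0 := hN₁.flow_ne_zero p
  have hC (p : N) (u v : TangentSpace (𝓡 (n - 1)) p) :
      ∃ c : ℝ, CovariantDerivative.difference D₁ D₂ p u v = c • ℓ₁ p :=
    (hN₁.flow_null p).exists_smul hι₁ (hN₁.flow_ne_zero p)
      (difference_null hLC₁ hLC₂ hι₁ hι₂ hN₁.induced hN₂.induced hq p u v)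
  -- Both coefficients contain the same derivative and quadratic terms in ω, so only ω(D₁ Y - D₂ Y)
  -- survives. The formula for D₂ is stated along ℓ₂ = r ℓ₁, and r ≠ 0 cancels by linearity in the
  -- first slot.
  have curv (a b : TangentSpace (𝓡 (n - 1)) p) : ∃ c₁ c₂ : ℝ,
      curvatureAt D₁ p (ℓ₁ p) a b = c₁ • ℓ₁ p ∧ curvatureAt D₂ p (ℓ₁ p) a b = c₂ • ℓ₁ p ∧
      c₁ - c₂ = rot p (CovariantDerivative.difference D₁ D₂ p b a) := by
    have hX := smoothAt_extend p a
    have hY := smoothAt_extend p b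
    have e₁ := hN₁.curvature_flow hLC₁ hrot₁ hX hY
    have e₂ := hN₂.curvature_flow hLC₂ hrot₂ hX hY
    have e₃ := difference_eq (D₁ := D₁) (D₂ := D₂) hY.diffAt a
    simp only [FiberBundle.extend_apply_self] at e₁ e₂ e₃
    rw [hr, curvatureAt_smul_left hD₂, smul_comm _ r] at e₂
    refine ⟨_, _, e₁, smul_right_injective _ hr0 e₂, ?_⟩
    rw [e₃, map_add]
    ring
  obtain ⟨c₁, c₂, h₁, h₂, h₁₂⟩ := curv v u
  obtain ⟨d₁, d₂, k₁, k₂, k₁₂⟩ := curv u v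
  have hnull₂ : InNullDirection g₂ ι₂ p (ℓ₁ p) := fun w =>
    (hq p _ w).symm.trans (hN₁.flow_null p w)
  have ric₁ := hN₁.induced.ricci_push hι₁ hLC₁ (hN₁.flow_null p) h0 v u k₁
  have ric₂ := hN₂.induced.ricci_push hι₂ hLC₂ hnull₂ h0 v u k₂
  rw [ricci_eq_of_vacuum hn hE₁ ⟨p, rfl⟩] at ric₁
  rw [ricci_eq_of_vacuum hn hE₂ ⟨p, rfl⟩] at ric₂
  have hq' : g₁.val (ι₁ p) (push ι₁ p v) (push ι₁ p u) = g₂.val (ι₂ p) (push ι₂ p v)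
      (push ι₂ p u) :=
    hq p v u
  have tr := trace_smul_vector (curvatureMap hD₁ p v u - curvatureMap hD₂ p v u) h0 (c := c₁ - c₂)
    (fun w => curvature_difference hD₁ hD₂ hN₁.flow_smooth hN₁.flow_ne_zero hrot hC p w v u)
    (by simp only [LinearMap.sub_apply, curvatureMap_apply, h₁, h₂, sub_smul])
  rw [map_sub] at tr
  have hsymm := difference_symm (hN₁.induced.torsion_eq_zero hι₁ hLC₁)
    (hN₂.induced.torsion_eq_zero hι₂ hLC₂) p u v
  rw [← hsymm] at k₁₂
  rw [hq'] at ric₁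
  -- The Ricci tensors agree; the difference of traces and the difference of transversal terms each
  -- equal ω(C(u,v)), the second by symmetry of C, so twice this number is zero.
  have hz : rot p (CovariantDerivative.difference D₁ D₂ p u v) = 0 := by linarith
  obtain ⟨c, hc⟩ := hC p u v
  rw [hc, map_smul, smul_eq_mul] at hz
  rw [hc, (mul_eq_zero.1 hz).resolve_right hκ, zero_smul]

end Rigidity

end NullSurface

end
-- Equality is asked on differentiable fields, as the axioms of a covariant derivative do not
-- constrain its values on other fields.
theorem theorem3 {n : ℕ} (hn : 2 < n)
    {N : Type*} [TopologicalSpace N] [ChartedSpace (EuclideanSpace ℝ (Fin (n - 1))) N]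
    [IsManifold (𝓡 (n - 1)) ∞ N]
    {M₁ : Type*} [TopologicalSpace M₁] [ChartedSpace (EuclideanSpace ℝ (Fin n)) M₁]
    [IsManifold (𝓡 n) ∞ M₁]
    {M₂ : Type*} [TopologicalSpace M₂] [ChartedSpace (EuclideanSpace ℝ (Fin n)) M₂]
    [IsManifold (𝓡 n) ∞ M₂]
    (g₁ : NullSurface.LorentzMetric n M₁) (nabla₁ : NullSurface.Connection n M₁)
    (hLC₁ : NullSurface.IsLeviCivita g₁ nabla₁)
    (g₂ : NullSurface.LorentzMetric n M₂) (nabla₂ : NullSurface.Connection n M₂)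
    (hLC₂ : NullSurface.IsLeviCivita g₂ nabla₂)
    (ι₁ : N → M₁) (D₁ : NullSurface.Connection (n - 1) N) (ℓ₁ : NullSurface.VField (n - 1) N)
    (hN₁ : NullSurface.IsIsolatedNullSurface g₁ nabla₁ ι₁ D₁ ℓ₁)
    (hκ₁ : NullSurface.IsNonExtremal D₁ ℓ₁)
    (ι₂ : N → M₂) (D₂ : NullSurface.Connection (n - 1) N) (ℓ₂ : NullSurface.VField (n - 1) N)
    (hN₂ : NullSurface.IsIsolatedNullSurface g₂ nabla₂ ι₂ D₂ ℓ₂)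
    (hκ₂ : NullSurface.IsNonExtremal D₂ ℓ₂)
    (Λ : ℝ)
    (hE₁ : NullSurface.VacuumEinsteinOn g₁ nabla₁ Λ (Set.range ι₁))
    (hE₂ : NullSurface.VacuumEinsteinOn g₂ nabla₂ Λ (Set.range ι₂))
    (hq : ∀ (p : N) (u v : TangentSpace (𝓡 (n - 1)) p),
      NullSurface.inducedMetric ι₁ g₁ p u v = NullSurface.inducedMetric ι₂ g₂ p u v)
    (rot : Π p : N, TangentSpace (𝓡 (n - 1)) p →L[ℝ] ℝ)
    (hrot₁ : NullSurface.IsRotationPotential D₁ ℓ₁ rot)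
    (hrot₂ : NullSurface.IsRotationPotential D₂ ℓ₂ rot) :
    ∀ (p : N) (Y : NullSurface.VField (n - 1) N), NullSurface.DiffAt Y p →
      D₁ Y p = D₂ Y p := by
  intro p Y hY
  ext v
  rw [NullSurface.difference_eq (D₁ := D₁) (D₂ := D₂) hY,
    NullSurface.difference_eq_zero hn hLC₁ hLC₂ hN₁ hκ₁ hN₂ hE₁ hE₂ hq hrot₁ hrot₂, add_zero]
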